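/- Let $s_1,g_1,s_2,g_2,\dots$ be independent uniformly distributed points of the unit square $[0,1]^2$; object $j$ has to be moved from its start $s_j$ to its goal $g_j$. Let $c_{pd}\ge 0$ be the cost of a pick-and-drop and $c_t\ge 0$ the cost per unit of distance. *Single arm.* For the first $n$ objects let $$C_{\rm single}(n)=n\,c_{pd}+c_t\sum_{j\le n}|s_j-g_j|+c_t\min_{\sigma\in S_n}\sum_{i=1}^{n-1}|g_{\sigma(i)}-s_{\sigma(i+1)}| ,$$ the cost of an optimal single-arm solution that moves every object once. *Two synchronized disc arms.* Let $n=2m$. A coordinated motion of two arms from places $(a_1,a_2)$ to places $(b_1,b_2)$ consists of two continuous rectifiable paths $\gamma_1,\gamma_2:[0,1]\to\mathbb R^2$, $\gamma_k(0)=a_k$, $\gamma_k(1)=b_k$ (the paths of the centres of two discs of radius $r\ge 0$) without collisions, i.e. $|\gamma_1(t)-\gamma_2(t)|\ge 2r$ for all $t$. Here pick-ups and drop-offs themselves are assumed to cause no collisions: if $|a_1-a_2|<2r$, then times $t$ with $|\gamma_k(t)-a_k|\le r$ for both $k$ are exempted, and likewise for $b_1,b_2$. The length of the motion is the maximum of the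 two arc lengths. A synchronized 2-arm solution is a sequence $\omega_1,\dots,\omega_m$ of pairs of objects $\omega_i=(o_i^1,o_i^2)$ that contains each of the $2m$ objects once, with a coordinated motion (transfer) from the starts to the goals of $\omega_i$ for each $i\le m$, and a coordinated motion (move) from the goals of $\omega_i$ to the starts of $\omega_{i+1}$ for each $i<m$. Its cost is $m\,c_{pd}+c_t\cdot(\text{sum of the lengths of all transfers and moves})$. *Random pairs.* For each $m$, independently of the starts and goals, split the first $2m$ objects uniformly at random into two randomly ordered sets of size $m$, one for each arm, and pair the $i$-th object of one set with the $i$-th object of the other. Let $\lambda=\mathtt E(l)$ and $\mu=\mathtt E(\max(l_1,l_2))$, where $l,l_1,l_2$ are i.i.d. copies of the distance of two independent uniform points of the unit square. **Theorem.** For all $r$ and $m$ there is a synchronized 2-arm solution (not depending on $c_{pd},c_t$) that transfers exactly the $m$ random pairs, in a suitable order, such that its cost $C^{\rm sync}_{\rm dual}(2m)$ satisfies: 1. For all $r,c_{pd},c_t\ge 0$ with $c_{pd}+c_t>0$ and all $\varepsilon>0$, almost surely for all sufficiently large $m$, $$\frac12+\frac{\frac{\mu-\lambda}{2}\,c_t}{c_{pd}+\lambda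 c_t}-\varepsilon<\frac{C^{\rm sync}_{\rm dual}(2m)}{C_{\rm single}(2m)}<\frac12+\frac{\left(\frac{\mu-\lambda}{2}+4\pi r\right)c_t}{c_{pd}+\lambda c_t}+\varepsilon .$$ 2. For all $r\ge0$ and $\varepsilon>0$ there is $\delta>0$ such that, whenever $c_{pd}>0$, $c_t\ge 0$ and $c_t/c_{pd}<\delta$, almost surely $\left|C^{\rm sync}_{\rm dual}(2m)/C_{\rm single}(2m)-\frac12\right|<\varepsilon$ for all sufficiently large $m$. 3. For all $\varepsilon>0$ there is $\delta>0$ such that, whenever $0\le r<\delta$, $c_t>0$, $c_{pd}\ge0$ and $c_{pd}/c_t<\delta$, almost surely $\left|C^{\rm sync}_{\rm dual}(2m)/C_{\rm single}(2m)-\frac{\mu}{2\lambda}\right|<\varepsilon$ for all sufficiently large $m$. Moreover $|\lambda-0.52|<0.005$, $|\mu-0.66|<0.005$ and $\left|\frac{\mu}{2\lambda}-0.64\right|<0.005$. -/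

import Mathlib

open MeasureTheory ProbabilityTheory Filter Set
open scoped NNReal ENNReal

noncomputable section

namespace DualArm

/-- The plane of the tabletop, with the Euclidean metric. -/
abbrev Plane : Type := EuclideanSpace ℝ (Fin 2)

/-- The unit square `[0,1]²`. -/
def unitSquare : Set Plane := {x | ∀ i, x i ∈ Set.Icc (0 : ℝ) 1}

/-- The uniform probability distribution on the unit square. -/
def uniformSquare : Measure Plane := cond volume unitSquare

/-- The expected length of one random transfer, `E(l)`. -/
def meanLength : ℝ := ∫ p : Plane × Plane, dist p.1 p.2 ∂(uniformSquare.prod uniformSquare)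

/-- `E(max(l₁, l₂))` for the lengths of two independent random transfers. -/
def meanMaxLength : ℝ :=
  ∫ q : (Plane × Plane) × (Plane × Plane), max (dist q.1.1 q.1.2) (dist q.2.1 q.2.2)
    ∂((uniformSquare.prod uniformSquare).prod (uniformSquare.prod uniformSquare))

/-! ### Single-arm solutions -/

/-- The length of the transits (from the goal of each object to the start of the next one)
of a single arm that handles the objects in the order `σ 0, σ 1, …, σ (n - 1)`. -/
def transitLength {n : ℕ} (s g : Fin n → Plane) (σ : Equiv.Perm (Fin n)) : ℝ :=
  ∑ i : Fin n, if h : (i : ℕ) + 1 < n then dist (g (σ i)) (s (σ ⟨(i : ℕ) + 1, h⟩)) else 0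

/-- The cost of an optimal single-arm solution: `n` pick-and-drops, the transfers, and the
transits in the best order. A single arm moves along straight segments. -/
def singleCost {n : ℕ} (cpd ct : ℝ) (s g : Fin n → Plane) : ℝ :=
  n * cpd + ct * ∑ i, dist (s i) (g i) + ct * ⨅ σ : Equiv.Perm (Fin n), transitLength s g σ

/-! ### Synchronized two-arm solutions with disc-shaped arms -/

/-- Assignments of `2m` objects to two arms: `e (i, k)` is the `i`-th object of arm `k`, so that
`(e (i, 0), e (i, 1))` is the `i`-th pair. This is a partition of the objects into two sets of `m`
objects, together with an ordering of each of the two sets. -/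
def Assignment (m : ℕ) : Type := (Fin m × Fin 2) ≃ Fin (2 * m)

instance (m : ℕ) : MeasurableSpace (Assignment m) := ⊤

/-- The object in the `i`-th pair that is handled by arm `k`. -/
def Assignment.obj {m : ℕ} (e : Assignment m) (i : Fin m) (k : Fin 2) : Fin (2 * m) :=
  Equiv.toFun e (i, k)

/-- The Euclidean arc length of a path parametrized by `[0,1]`. -/
def arcLength (γ : ℝ → Plane) : ℝ := (eVariationOn γ (Set.Icc 0 1)).toReal

/-- `γ 0` and `γ 1` are paths of the centres of two discs of radius `r` which move simultaneously
from the places `a 0, a 1` to the places `b 0, b 1` without collision: the interiors of the discs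
are disjoint at all times. Pick-ups and drop-offs themselves are assumed not to cause collisions:
if the two places `a 0, a 1` at which the motion begins (or `b 0, b 1`, at which it ends) are so
close to each other that the two discs overlap there, then overlapping is not counted as a
collision while each of the two discs covers its own place. -/
structure IsCoordinatedMotion (r : ℝ≥0) (a b : Fin 2 → Plane) (γ : Fin 2 → ℝ → Plane) :
    Prop where
  continuousOn : ∀ k, ContinuousOn (γ k) (Set.Icc 0 1)
  rectifiable : ∀ k, BoundedVariationOn (γ k) (Set.Icc 0 1)
  source : ∀ k, γ k 0 = a k
  target : ∀ k, γ k 1 = b k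
  collisionFree : ∀ t ∈ Set.Icc (0 : ℝ) 1,
    2 * (r : ℝ) ≤ dist (γ 0 t) (γ 1 t) ∨
    (dist (a 0) (a 1) < 2 * (r : ℝ) ∧ ∀ k, dist (γ k t) (a k) ≤ r) ∨
    (dist (b 0) (b 1) < 2 * (r : ℝ) ∧ ∀ k, dist (γ k t) (b k) ≤ r)

/-- The length of a simultaneous motion of both arms: the maximum of the two arc lengths. -/
def motionLength (γ : Fin 2 → ℝ → Plane) : ℝ := max (arcLength (γ 0)) (arcLength (γ 1))

/-- A synchronized monotone two-arm solution for `2m` objects with starts `s` and goals `g`: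
simultaneous transfers of the pairs `0, 1, …, m - 1`, and between the transfers of two successive
pairs a simultaneous move of both arms. (`move i` is irrelevant for the last index.) -/
structure SyncSolution (r : ℝ≥0) {m : ℕ} (s g : Fin (2 * m) → Plane) where
  assignment : Assignment m
  transfer : Fin m → Fin 2 → ℝ → Plane
  move : Fin m → Fin 2 → ℝ → Plane
  transfer_spec : ∀ i, IsCoordinatedMotion r
    (fun k => s (assignment.obj i k)) (fun k => g (assignment.obj i k)) (transfer i)
  move_spec : ∀ (i : Fin m) (h : (i : ℕ) + 1 < m), IsCoordinatedMotion r
    (fun k => g (assignment.obj i k))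
    (fun k => s (assignment.obj ⟨(i : ℕ) + 1, h⟩ k)) (move i)

/-- The cost of a synchronized solution: `cpd` for each simultaneous pick-and-drop of a pair, and
`ct` per unit of the sum, over all transfers and moves, of the larger of the two arc lengths. -/
def SyncSolution.cost {r : ℝ≥0} {m : ℕ} {s g : Fin (2 * m) → Plane} (D : SyncSolution r s g)
    (cpd ct : ℝ) : ℝ :=
  m * cpd + ct * ∑ i, motionLength (D.transfer i)
    + ct * ∑ i : Fin m, if (i : ℕ) + 1 < m then motionLength (D.move i) else 0

/-- The solution transfers exactly the pairs of the assignment `e`, in some order. -/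
def SyncSolution.HasPairs {r : ℝ≥0} {m : ℕ} {s g : Fin (2 * m) → Plane} (D : SyncSolution r s g)
    (e : Assignment m) : Prop :=
  ∃ σ : Equiv.Perm (Fin m), ∀ i k, D.assignment.obj i k = e.obj (σ i) k

/-! ### The random model -/

/-- The first `n` points of a random sequence of points. -/
def firstPoints {Ω : Type*} (x : ℕ → Ω → Plane) (n : ℕ) (ω : Ω) : Fin n → Plane :=
  fun i => x i ω

/-- The starts and goals of the objects are independent and uniform in the unit square, and for each
`m` the first `2m` objects are randomly partitioned into two randomly ordered sets of size `m`,
uniformly and independently of the starts and goals. -/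
structure IsRandomModel {Ω : Type*} [MeasurableSpace Ω] (P : Measure Ω)
    (start goal : ℕ → Ω → Plane) (split : ∀ m, Ω → Assignment m) : Prop where
  measurable_start : ∀ i, Measurable (start i)
  measurable_goal : ∀ i, Measurable (goal i)
  map_start : ∀ i, P.map (start i) = uniformSquare
  map_goal : ∀ i, P.map (goal i) = uniformSquare
  indep_points : iIndepFun (Sum.elim start goal) P
  measurable_split : ∀ m, Measurable (split m)
  map_split : ∀ m, P.map (split m) = uniformOn Set.univ
  indep_split : ∀ m, IndepFun (split m) (fun ω (j : ℕ ⊕ ℕ) => Sum.elim start goal j ω) P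

end DualArm

end

/-! Per random pair, the synchronized solution costs asymptotically `cpd + μ ct`, plus at most `4 r
ct` for collision avoidance. The single arm costs `2 (cpd + λ ct)` for the same two objects. The
quotient is `1/2 + ((μ - λ)/2) ct / (cpd + λ ct)`, with an error of at most `2 r ct / (cpd + λ ct)`.
Three facts make this work.

Collisions are cheap (`exists_isCoordinatedMotion`). Choose a unit vector `n` orthogonal to the
change of the relative position of the arms. Push the arms apart by `r` each along `n`, translate
both, and undo the push. During the translation the relative position has component at least `2 r`
along `n`, so each motion is at most `2 r` longer than the larger straight distance. It is never
shorter than that distance (`IsCoordinatedMotion.le_motionLength`).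

Moves without objects are asymptotically free, apart from detours. Divide the square into small
cells and classify each pair by the cells of its two starts and of its two goals. Exchanging starts
and goals preserves the law, so about as many pairs go from class `x` to class `y` as back.
Alternating between them makes nearly every move short (`hasOrdering_of_balanced`,
`IsRandomModel.eventually_hasOrdering`). One arm running through the first objects of all pairs in
this order and then through the second ones shows that single-arm transits are sublinear too.

The transfers obey a law of large numbers (`IsRandomModel.tendsto_pair_average`). Since the pairing
changes with `m` and nothing is assumed about the joint law of different pairings, this is proved by
Hoeffding's inequality for each fixed assignment, a union over the values of the split, and
Borel–Cantelli.

For the numerical values, the distribution function of a transfer length is computed exactly on `[0,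
1]`. Lengths above 1 contribute little, and the exact second moment bounds that contribution
(`mean_numerical_bounds`). -/

namespace DualArm

/-! ### Collision-free motions -/

lemma eVariationOn_affine_le {E : Type*} [NormedAddCommGroup E] [NormedSpace ℝ E]
    {γ : ℝ → E} {x y : ℝ} (hxy : x ≤ y) (c v : E) (h : ∀ t ∈ Icc x y, γ t = c + t • v) :
    eVariationOn γ (Icc x y) ≤ ENNReal.ofReal (‖v‖ * (y - x)) := by
  rw [eVariationOn.congr h]
  have h1 : LipschitzOnWith ‖v‖₊ (fun t : ℝ => c + t • v) univ := by
    refine LipschitzOnWith.of_dist_le_mul fun s _ t _ => ?_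
    simp only [dist_eq_norm, add_sub_add_left_eq_sub, ← sub_smul, norm_smul, coe_nnnorm]
    rw [mul_comm]
  have h2 := h1.comp_eVariationOn_le (g := (id : ℝ → ℝ)) (s := Icc x y) (fun _ _ => mem_univ _)
  have h3 := (monotoneOn_id (s := Icc x y)).eVariationOn_eq (left_mem_Icc.2 hxy)
    (right_mem_Icc.2 hxy)
  simp only [inter_self, id] at h3
  refine h2.trans ?_
  rw [ENNReal.ofReal_mul (norm_nonneg _), ofReal_norm]
  gcongr ?_ * ?_
  · exact le_rfl
  · exact h3.le

/-- Some unit vector is orthogonal to `v` and makes an angle of at most `π / 2` with `p`. -/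
lemma exists_unit_orthogonal (v p : Plane) :
    ∃ n : Plane, ‖n‖ = 1 ∧ inner ℝ v n = 0 ∧ 0 ≤ inner ℝ p n := by
  obtain ⟨n, hn, hv⟩ : ∃ n : Plane, ‖n‖ = 1 ∧ inner ℝ v n = 0 := by
    by_cases hv : v = 0
    · exact ⟨EuclideanSpace.single 0 1, by simp, by simp [hv]⟩
    · set w : Plane := !₂[-v 1, v 0] with hw
      have hvw : ‖w‖ = ‖v‖ := by
        simp [EuclideanSpace.norm_eq, hw, Fin.sum_univ_two, add_comm]
      have hw0 : ‖w‖ ≠ 0 := by rw [hvw]; exact norm_ne_zero_iff.2 hv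
      refine ⟨‖w‖⁻¹ • w, by rw [norm_smul, norm_inv, norm_norm, inv_mul_cancel₀ hw0], ?_⟩
      rw [inner_smul_right]
      have : inner ℝ v w = 0 := by
        simp [PiLp.inner_apply, hw, Fin.sum_univ_two]; ring
      rw [this, mul_zero]
  rcases le_total 0 (inner ℝ p n) with h | h
  · exact ⟨n, hn, hv, h⟩
  · exact ⟨-n, by rwa [norm_neg], by rw [inner_neg_right, hv, neg_zero],
      by rw [inner_neg_right]; linarith⟩

/-- Progress along the direct segment at time `t`. -/
def detourProgress (t : ℝ) : ℝ := max 0 (min 1 (3 * t - 1))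

/-- Relative distance from the direct segment at time `t`. -/
def detourHeight (t : ℝ) : ℝ := max 0 (min 1 (min (3 * t) (3 - 3 * t)))

/-- The path which moves from `a` by `u`, then parallel to the segment from `a` to `b`, and finally
by `-u` to `b`. -/
def detour (a b u : Plane) (t : ℝ) : Plane :=
  a + detourProgress t • (b - a) + detourHeight t • u

lemma detourProgress_first {t : ℝ} (h : t ≤ 1 / 3) : detourProgress t = 0 := by
  unfold detourProgress
  rw [max_eq_left]; exact (min_le_right _ _).trans (by linarith)

lemma detourProgress_second {t : ℝ} (h : 1 / 3 ≤ t) (h' : t ≤ 2 / 3) :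
    detourProgress t = 3 * t - 1 := by
  unfold detourProgress
  rw [min_eq_right (by linarith), max_eq_right (by linarith)]

lemma detourProgress_third {t : ℝ} (h : 2 / 3 ≤ t) : detourProgress t = 1 := by
  unfold detourProgress
  rw [min_eq_left (by linarith), max_eq_right (by linarith)]

lemma detourHeight_first {t : ℝ} (h : 0 ≤ t) (h' : t ≤ 1 / 3) : detourHeight t = 3 * t := by
  unfold detourHeight
  rw [min_eq_left (b := 3 - 3 * t) (by linarith), min_eq_right (by linarith),
    max_eq_right (by linarith)]

lemma detourHeight_second {t : ℝ} (h : 1 / 3 ≤ t) (h' : t ≤ 2 / 3) : detourHeight t = 1 := by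
  unfold detourHeight
  rw [min_eq_left (b := min _ _) (le_min (by linarith) (by linarith)), max_eq_right (by linarith)]

lemma detourHeight_third {t : ℝ} (h : 2 / 3 ≤ t) (h' : t ≤ 1) : detourHeight t = 3 - 3 * t := by
  unfold detourHeight
  rw [min_eq_right (b := 3 - 3 * t) (by linarith), min_eq_right (by linarith),
    max_eq_right (by linarith)]

lemma detourHeight_nonneg (t : ℝ) : 0 ≤ detourHeight t := le_max_left _ _

lemma detourHeight_le_one (t : ℝ) : detourHeight t ≤ 1 :=
  max_le zero_le_one (min_le_left _ _)

lemma continuous_detour (a b u : Plane) : Continuous (detour a b u) := by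
  unfold detour detourProgress detourHeight
  fun_prop

lemma eVariationOn_detour_le (a b u : Plane) :
    eVariationOn (detour a b u) (Icc 0 1) ≤ ENNReal.ofReal (dist a b + 2 * ‖u‖) := by
  have e1 := eVariationOn.Icc_add_Icc (detour a b u) (s := univ) (a := 0) (b := 1 / 3) (c := 1)
    (by norm_num) (by norm_num) (mem_univ _)
  have e2 := eVariationOn.Icc_add_Icc (detour a b u) (s := univ) (a := 1 / 3) (b := 2 / 3) (c := 1)
    (by norm_num) (by norm_num) (mem_univ _)
  simp only [univ_inter] at e1 e2
  rw [← e1, ← e2]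
  have h1 := eVariationOn_affine_le (γ := detour a b u) (x := 0) (y := 1 / 3) (by norm_num) a
    ((3 : ℝ) • u) (fun t ht => by
      rw [detour, detourProgress_first ht.2, detourHeight_first ht.1 ht.2]; module)
  have h2 := eVariationOn_affine_le (γ := detour a b u) (x := 1 / 3) (y := 2 / 3) (by norm_num)
    (a - (b - a) + u) ((3 : ℝ) • (b - a)) (fun t ht => by
      rw [detour, detourProgress_second ht.1 ht.2, detourHeight_second ht.1 ht.2]; module)
  have h3 := eVariationOn_affine_le (γ := detour a b u) (x := 2 / 3) (y := 1) (by norm_num)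
    (b + (3 : ℝ) • u) (-((3 : ℝ) • u)) (fun t ht => by
      rw [detour, detourProgress_third ht.1, detourHeight_third ht.1 ht.2]; module)
  refine (add_le_add h1 (add_le_add h2 h3)).trans ?_
  rw [← ENNReal.ofReal_add (by positivity) (by positivity),
    ← ENNReal.ofReal_add (by positivity) (by positivity)]
  apply ENNReal.ofReal_le_ofReal
  rw [dist_comm, dist_eq_norm]
  simp only [norm_smul, norm_neg, Real.norm_ofNat]
  linarith

lemma detour_source (a b u : Plane) : detour a b u 0 = a := by
  rw [detour, detourProgress_first (by norm_num), detourHeight_first le_rfl (by norm_num)]; module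

lemma detour_target (a b u : Plane) : detour a b u 1 = b := by
  rw [detour, detourProgress_third (by norm_num), detourHeight_third (by norm_num) le_rfl]; module

lemma norm_le_norm_add_smul {p n : Plane} {h : ℝ} (hp : 0 ≤ inner ℝ p n) (hh : 0 ≤ h) :
    ‖p‖ ≤ ‖p + h • n‖ := by
  refine le_of_sq_le_sq ?_ (norm_nonneg _)
  rw [norm_add_sq_real, inner_smul_right]
  nlinarith [mul_nonneg hh hp, sq_nonneg ‖h • n‖]

/-- Two discs of radius `r` can move simultaneously between any places without collision, with a
detour of at most `2 r`. -/
theorem exists_isCoordinatedMotion (r : ℝ≥0) (a b : Fin 2 → Plane) :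
    ∃ γ, IsCoordinatedMotion r a b γ ∧
      motionLength γ ≤ max (dist (a 0) (b 0)) (dist (a 1) (b 1)) + 2 * r := by
  -- Orthogonality to the change of the relative position keeps its component along `n` constant
  -- during the translation; the sign of `n` makes this component nonnegative.
  obtain ⟨n, hn, hv, hp⟩ := exists_unit_orthogonal (b 0 - b 1 - (a 0 - a 1)) (a 0 - a 1)
  have hq : inner ℝ (b 0 - b 1) n = inner ℝ (a 0 - a 1) n := by
    rw [inner_sub_left] at hv; linarith
  set u : Fin 2 → Plane := ![(r : ℝ) • n, -((r : ℝ) • n)] with hu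
  have hun : ∀ k, ‖u k‖ = r := by
    intro k; fin_cases k <;> simp [hu, norm_smul, hn]
  have hvar : ∀ k, eVariationOn (detour (a k) (b k) (u k)) (Icc 0 1)
      ≤ ENNReal.ofReal (dist (a k) (b k) + 2 * r) := fun k => by
    simpa only [hun] using eVariationOn_detour_le (a k) (b k) (u k)
  refine ⟨fun k => detour (a k) (b k) (u k),
    ⟨fun k => (continuous_detour _ _ _).continuousOn,
      fun k => ne_top_of_le_ne_top ENNReal.ofReal_ne_top (hvar k),
      fun k => detour_source _ _ _, fun k => detour_target _ _ _, fun t ht => ?_⟩, ?_⟩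
  · have hrel : detour (a 0) (b 0) (u 0) t - detour (a 1) (b 1) (u 1) t
        = (a 0 - a 1) + detourProgress t • (b 0 - b 1 - (a 0 - a 1))
          + (2 * r * detourHeight t) • n := by
      simp only [detour, hu, Matrix.cons_val_zero, Matrix.cons_val_one]
      module
    have hmove : ∀ k, ‖detourHeight t • u k‖ ≤ r := fun k => by
      rw [norm_smul, hun, Real.norm_of_nonneg (detourHeight_nonneg t)]
      exact mul_le_of_le_one_left r.2 (detourHeight_le_one t)
    have hh : 0 ≤ 2 * (r : ℝ) * detourHeight t :=
      mul_nonneg (by positivity) (detourHeight_nonneg t)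
    -- In the outer thirds each centre stays within `r` of its own place, so places that are too
    -- close fall under the exemption; otherwise the push along `n` only increases the distance. In
    -- the middle third the component along `n` is at least `2 r`.
    rcases le_total t (1 / 3) with h1 | h1
    · by_cases hc : dist (a 0) (a 1) < 2 * r
      · refine Or.inr (Or.inl ⟨hc, fun k => ?_⟩)
        rw [detour, detourProgress_first h1, dist_eq_norm]
        simpa using hmove k
      · left
        rw [dist_eq_norm, hrel, detourProgress_first h1, zero_smul, add_zero]
        rw [not_lt, dist_eq_norm] at hc
        exact hc.trans (norm_le_norm_add_smul hp hh)
    · rcases le_total t (2 / 3) with h2 | h2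
      · left
        rw [dist_eq_norm, hrel, detourHeight_second h1 h2]
        have key := real_inner_le_norm ((a 0 - a 1)
          + detourProgress t • (b 0 - b 1 - (a 0 - a 1)) + (2 * (r : ℝ) * 1) • n) n
        rw [inner_add_left, inner_add_left, inner_smul_left, inner_smul_left, hv,
          real_inner_self_eq_norm_sq, hn] at key
        simp only [map_mul, conj_trivial, mul_zero, mul_one, one_pow] at key ⊢
        linarith
      · by_cases hc : dist (b 0) (b 1) < 2 * r
        · refine Or.inr (Or.inr ⟨hc, fun k => ?_⟩)
          rw [detour, detourProgress_third h2, dist_eq_norm]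
          simpa using hmove k
        · left
          rw [dist_eq_norm, hrel, detourProgress_third h2, one_smul, add_sub_cancel]
          rw [not_lt, dist_eq_norm] at hc
          exact hc.trans (norm_le_norm_add_smul (hq ▸ hp) hh)
  · have harc : ∀ k, arcLength (detour (a k) (b k) (u k)) ≤ dist (a k) (b k) + 2 * r := fun k =>
      ENNReal.toReal_le_of_le_ofReal (by positivity) (hvar k)
    exact max_le ((harc 0).trans (by gcongr; exact le_max_left _ _))
      ((harc 1).trans (by gcongr; exact le_max_right _ _))

/-- An arc is at least as long as its chord. This is the source of the lower bound for the cost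
ratio. -/
lemma IsCoordinatedMotion.le_motionLength {r : ℝ≥0} {a b : Fin 2 → Plane} {γ : Fin 2 → ℝ → Plane}
    (h : IsCoordinatedMotion r a b γ) :
    max (dist (a 0) (b 0)) (dist (a 1) (b 1)) ≤ motionLength γ := by
  have hk : ∀ k, dist (a k) (b k) ≤ arcLength (γ k) := fun k => by
    have := (h.rectifiable k).dist_le (left_mem_Icc.2 zero_le_one) (right_mem_Icc.2 zero_le_one)
    rwa [h.source, h.target] at this
  exact max_le_max (hk 0) (hk 1)

/-! ### Cheap orderings -/

/-- The sum of the costs of the pairs of successive members of a list. -/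
def pathCost {ι : Type*} (c : ι → ι → ℝ) : List ι → ℝ
  | [] => 0
  | [_] => 0
  | a :: b :: l => c a b + pathCost c (b :: l)

/-- The sum of the costs of the pairs of successive members of an ordering of `Fin n`. -/
def orderCost {n : ℕ} {ι : Type*} (c : ι → ι → ℝ) (σ : Fin n → ι) : ℝ :=
  ∑ i : Fin n, if h : (i : ℕ) + 1 < n then c (σ i) (σ ⟨(i : ℕ) + 1, h⟩) else 0

section pathCost

variable {ι : Type*} {c : ι → ι → ℝ} {D η : ℝ}

lemma pathCost_le_of_isChain (hη : 0 ≤ η) :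
    ∀ {l : List ι}, l.IsChain (fun a b => c a b ≤ η) → pathCost c l ≤ η * l.length
  | [], _ => by simp [pathCost]
  | [_], _ => by simpa [pathCost] using hη
  | a :: b :: l, h => by
    rw [List.isChain_cons_cons] at h
    have := pathCost_le_of_isChain hη h.2
    simp only [pathCost, List.length_cons, Nat.cast_add, Nat.cast_one] at this ⊢
    linarith [h.1]

/-- Only the junction is new, and `D` pays for it; an empty list has no junction, hence `0 ≤ D`. -/
lemma pathCost_append_le (hD : ∀ a b, c a b ≤ D) (hD0 : 0 ≤ D) :
    ∀ l₁ l₂ : List ι, pathCost c (l₁ ++ l₂) ≤ pathCost c l₁ + pathCost c l₂ + D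
  | [], l₂ => by simpa [pathCost] using hD0
  | [a], [] => by simpa [pathCost] using hD0
  | [a], b :: l => by simp [pathCost]; linarith [hD a b]
  | a :: b :: l, l₂ => by
    have := pathCost_append_le hD hD0 (b :: l) l₂
    simp only [List.cons_append, pathCost] at this ⊢
    linarith

lemma pathCost_mono {c' : ι → ι → ℝ} (h : ∀ a b, c a b ≤ c' a b) :
    ∀ l : List ι, pathCost c l ≤ pathCost c' l
  | [] => le_rfl
  | [_] => le_rfl
  | a :: b :: l => add_le_add (h a b) (pathCost_mono h (b :: l))

lemma pathCost_map {κ : Type*} (f : κ → ι) :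
    ∀ l : List κ, pathCost c (l.map f) = pathCost (fun a b => c (f a) (f b)) l
  | [] => rfl
  | [_] => rfl
  | a :: b :: l => by
    have := pathCost_map f (b :: l)
    simp only [List.map_cons, pathCost] at this ⊢
    rw [this]

lemma pathCost_eq_orderCost : ∀ l : List ι, pathCost c l = orderCost c l.get
  | [] => by simp [pathCost, orderCost]
  | [a] => by simp [pathCost, orderCost]
  | a :: b :: l => by
    have := pathCost_eq_orderCost (b :: l)
    unfold orderCost at this ⊢
    rw [pathCost, this]
    simp only [List.length_cons]
    rw [Fin.sum_univ_succ (n := l.length + 1)]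
    congr 1
    · simp

lemma exists_perm_orderCost_eq {n : ℕ} {c : Fin n → Fin n → ℝ} (l : List (Fin n)) (hl : l.Nodup)
    (hmem : ∀ i, i ∈ l) : ∃ σ : Equiv.Perm (Fin n), orderCost c σ = pathCost c l := by
  classical
  have hlen : n = l.length := by
    have h := List.toFinset_card_of_nodup hl
    rw [show l.toFinset = Finset.univ by ext; simp [hmem], Finset.card_univ, Fintype.card_fin] at h
    exact h
  refine ⟨(finCongr hlen).trans (hl.getEquivOfForallMemList l hmem), ?_⟩
  rw [pathCost_eq_orderCost, orderCost, orderCost]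
  refine Fintype.sum_equiv (finCongr hlen) _ _ fun i => ?_
  by_cases h : (i : ℕ) + 1 < n
  · rw [dif_pos h, dif_pos (by simpa [← hlen] using h)]; rfl
  · rw [dif_neg h, dif_neg (by simpa [← hlen] using h)]

/-- Alternate: a member of `A` ends at `y`, where the next member of `B` begins, and that one
returns to `x`. The condition on the head is what lets the induction attach two more members in
front. -/
lemma exists_interleaving {T : Type*} {src tgt : ι → T} (hη : 0 ≤ η)
    (hc : ∀ a b, tgt a = src b → c a b ≤ η) {x y : T} :
    ∀ A B : List ι, A.length = B.length → (∀ a ∈ A, src a = x ∧ tgt a = y) →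
      (∀ b ∈ B, src b = y ∧ tgt b = x) →
      ∃ l : List ι, l.Perm (A ++ B) ∧ l.IsChain (fun a b => c a b ≤ η) ∧
        ∀ a ∈ l.head?, src a = x
  | [], [], _, _, _ => ⟨[], by simp, .nil, by simp⟩
  | a :: A, b :: B, hl, hA, hB => by
    obtain ⟨l, h1, h2, h3⟩ := exists_interleaving hη hc A B (by simpa using hl)
      (fun a h => hA a (List.mem_cons_of_mem _ h)) (fun b h => hB b (List.mem_cons_of_mem _ h))
    have ha := hA a List.mem_cons_self
    have hb := hB b List.mem_cons_self
    refine ⟨a :: b :: l, ?_, ?_, by simp [ha.1]⟩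
    · rw [List.cons_append, List.perm_cons]
      exact (h1.cons b).trans List.perm_middle.symm
    · rw [List.isChain_cons_cons]
      refine ⟨hc a b (ha.2.trans hb.1.symm), ?_⟩
      rw [List.isChain_cons]
      exact ⟨fun d hd => hc b d (hb.2.trans (h3 d hd).symm), h2⟩

end pathCost

section enumeration

variable {ι : Type*} [DecidableEq ι]

/-- The members of `S` can be ordered with cost at most `B`. -/
def HasOrdering (c : ι → ι → ℝ) (S : Finset ι) (B : ℝ) : Prop :=
  ∃ l : List ι, l.Nodup ∧ l.toFinset = S ∧ pathCost c l ≤ B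

variable {c : ι → ι → ℝ} {D η : ℝ}

lemma HasOrdering.mono {S : Finset ι} {B B' : ℝ} (h : HasOrdering c S B) (hB : B ≤ B') :
    HasOrdering c S B' :=
  let ⟨l, h1, h2, h3⟩ := h
  ⟨l, h1, h2, h3.trans hB⟩

lemma hasOrdering_of_forall_le (hη : 0 ≤ η) {S : Finset ι}
    (h : ∀ a ∈ S, ∀ b ∈ S, c a b ≤ η) : HasOrdering c S (η * S.card) := by
  refine ⟨S.toList, S.nodup_toList, S.toList_toFinset, ?_⟩
  rw [← S.length_toList]
  refine pathCost_le_of_isChain hη (List.Pairwise.isChain ?_)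
  exact List.pairwise_of_forall_mem_list fun a ha b hb =>
    h a (Finset.mem_toList.1 ha) b (Finset.mem_toList.1 hb)

lemma HasOrdering.union (hD : ∀ a b, c a b ≤ D) (hD0 : 0 ≤ D) {S S' : Finset ι} {B B' : ℝ}
    (hS : Disjoint S S') (h : HasOrdering c S B) (h' : HasOrdering c S' B') :
    HasOrdering c (S ∪ S') (B + B' + D) := by
  obtain ⟨l, h1, rfl, h3⟩ := h
  obtain ⟨l', h1', rfl, h3'⟩ := h'
  refine ⟨l ++ l', h1.append h1' ?_, by simp, ?_⟩
  · rwa [List.disjoint_toFinset_iff_disjoint] at hS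
  · exact (pathCost_append_le hD hD0 l l').trans (by linarith)

lemma HasOrdering.biUnion {κ : Type*} [DecidableEq κ] (hD : ∀ a b, c a b ≤ D) (hD0 : 0 ≤ D)
    {S : κ → Finset ι} {B : κ → ℝ} (t : Finset κ)
    (hS : ∀ k k', k ≠ k' → Disjoint (S k) (S k'))
    (h : ∀ k, HasOrdering c (S k) (B k)) :
    HasOrdering c (t.biUnion S) (∑ k ∈ t, (B k + D)) := by
  induction t using Finset.induction_on with
  | empty => exact ⟨[], by simp, by simp, by simp [pathCost]⟩
  | insert k t hk ih =>
    rw [Finset.biUnion_insert, Finset.sum_insert hk]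
    refine (HasOrdering.union hD hD0 ?_ (h k) ih).mono (by linarith)
    rw [Finset.disjoint_biUnion_right]
    exact fun k' hk' => hS k k' fun h => hk (h ▸ hk')

/-- Interleave `A` with an equally large part of `B`; the surplus of `B` follows in any order at
cost `D` per member, and one more `D` joins the two lists. -/
lemma hasOrdering_union_of_card_le {T : Type*} {src tgt : ι → T} (hη : 0 ≤ η)
    (hc : ∀ a b, tgt a = src b → c a b ≤ η) (hD : ∀ a b, c a b ≤ D) (hD0 : 0 ≤ D) {x y : T}
    {A B : Finset ι} (hAB : Disjoint A B) (hcard : A.card ≤ B.card)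
    (hA : ∀ a ∈ A, src a = x ∧ tgt a = y) (hB : ∀ b ∈ B, src b = y ∧ tgt b = x) :
    HasOrdering c (A ∪ B) (η * (A ∪ B).card + D * ((B.card : ℝ) - A.card) + D) := by
  obtain ⟨B', hB', hcard'⟩ := Finset.exists_subset_card_eq hcard
  obtain ⟨l, h1, h2, -⟩ := exists_interleaving hη hc A.toList B'.toList (by simp [hcard'])
    (fun a h => hA a (Finset.mem_toList.1 h)) (fun b h => hB b (hB' (Finset.mem_toList.1 h)))
  have hfirst : HasOrdering c (A ∪ B') (η * (A ∪ B).card) := by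
    refine ⟨l, ?_, ?_, ?_⟩
    · rw [h1.nodup_iff]
      refine A.nodup_toList.append B'.nodup_toList ?_
      rw [← List.disjoint_toFinset_iff_disjoint]
      simpa using hAB.mono_right hB'
    · rw [List.toFinset_eq_of_perm _ _ h1]; simp
    · refine (pathCost_le_of_isChain hη h2).trans (mul_le_mul_of_nonneg_left ?_ hη)
      rw [h1.length_eq, List.length_append, Finset.length_toList, Finset.length_toList,
        ← Finset.card_union_of_disjoint (hAB.mono_right hB')]
      exact_mod_cast Finset.card_le_card (Finset.union_subset_union_right hB')
  have hrest := hasOrdering_of_forall_le (S := B \ B') hD0 (fun a _ b _ => hD a b)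
  have hdisj : Disjoint (A ∪ B') (B \ B') :=
    Finset.disjoint_union_left.2 ⟨hAB.mono_right Finset.sdiff_subset, Finset.disjoint_sdiff⟩
  have := hfirst.union hD hD0 hdisj hrest
  rw [Finset.union_assoc, Finset.union_sdiff_of_subset hB', Finset.card_sdiff_of_subset hB',
    Nat.cast_sub (hcard' ▸ hcard), hcard'] at this
  exact this.mono (by linarith)

/-- If about as many objects move from `x` to `y` as from `y` to `x`, for all `x` and `y` in a
finite type, then the objects can be ordered such that most of them begin where the preceding one
ends. -/
theorem hasOrdering_of_balanced [Fintype ι] {T : Type*} [Fintype T] [DecidableEq T]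
    {src tgt : ι → T} (hη : 0 ≤ η) (hc : ∀ a b, tgt a = src b → c a b ≤ η)
    (hD : ∀ a b, c a b ≤ D) (hD0 : 0 ≤ D) {M : ℝ} (hM0 : 0 ≤ M)
    (hM : ∀ x y, ((Finset.univ.filter fun a => src a = x ∧ tgt a = y).card : ℝ)
      - (Finset.univ.filter fun a => src a = y ∧ tgt a = x).card ≤ M) :
    HasOrdering c Finset.univ
      (η * Fintype.card ι + Fintype.card (Sym2 T) * (D * (M + 2))) := by
  -- Unordered pairs of types put each class and its reverse into one group, which can be
  -- interleaved.
  set S : Sym2 T → Finset ι := fun k => Finset.univ.filter fun a => s(src a, tgt a) = k with hS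
  have hgroup : ∀ k, HasOrdering c (S k) (η * (S k).card + D * (M + 1)) := by
    intro k
    induction k using Sym2.ind with | _ x y
    set A := Finset.univ.filter fun a => src a = x ∧ tgt a = y with hA
    set B := Finset.univ.filter fun a => src a = y ∧ tgt a = x with hB
    have hSAB : S s(x, y) = A ∪ B := by
      ext a; simp [hS, hA, hB]
    have hA' : ∀ a ∈ A, src a = x ∧ tgt a = y := by simp [hA]
    have hB' : ∀ a ∈ B, src a = y ∧ tgt a = x := by simp [hB]
    -- On the diagonal there is nothing to balance: every member begins where every other one ends.
    by_cases hxy : x = y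
    · refine (hasOrdering_of_forall_le hη fun a ha b hb => hc a b ?_).mono
        (le_add_of_nonneg_right (by positivity))
      subst hxy
      simp only [hSAB, hA, hB, Finset.union_self, Finset.mem_filter, Finset.mem_univ,
        true_and] at ha hb
      rw [ha.2, hb.1]
    · have hAB : Disjoint A B := by
        rw [Finset.disjoint_left]
        intro a ha hb
        exact hxy ((hA' a ha).1.symm.trans (hB' a hb).1)
      rw [hSAB]
      rcases le_total A.card B.card with h | h
      · refine (hasOrdering_union_of_card_le hη hc hD hD0 hAB h hA' hB').mono ?_
        linarith [mul_le_mul_of_nonneg_left (hM y x) hD0]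
      · rw [Finset.union_comm]
        refine (hasOrdering_union_of_card_le hη hc hD hD0 hAB.symm h hB' hA').mono ?_
        linarith [mul_le_mul_of_nonneg_left (hM x y) hD0]
  have hall := HasOrdering.biUnion hD hD0 Finset.univ (S := S) (fun k k' hk => by
    rw [Finset.disjoint_left]
    intro a ha ha'
    simp only [hS, Finset.mem_filter, Finset.mem_univ, true_and] at ha ha'
    exact hk (ha.symm.trans ha')) hgroup
  have huniv : Finset.univ.biUnion S = Finset.univ := by ext; simp [hS]
  rw [huniv] at hall
  refine hall.mono (le_of_eq ?_)
  have hcard : ∑ k, ((S k).card : ℝ) = Fintype.card ι := by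
    rw [← Nat.cast_sum, ← Finset.card_univ]
    exact_mod_cast (Finset.card_eq_sum_card_fiberwise (f := fun a => s(src a, tgt a))
      (t := Finset.univ) (fun _ _ => Finset.mem_coe.2 (Finset.mem_univ _))).symm
  rw [Finset.sum_add_distrib, Finset.sum_add_distrib, ← Finset.mul_sum, hcard]
  simp only [Finset.sum_const, Finset.card_univ, nsmul_eq_mul]
  ring

end enumeration

/-! ### Orderings of the objects of a single arm -/

/-- The larger of the distances from the goals of the pair `i` to the starts of the pair `j`. -/
noncomputable def pairMoveCost {m : ℕ} (e : Assignment m) (s g : Fin (2 * m) → Plane)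
    (i j : Fin m) : ℝ :=
  max (dist (g (e.obj i 0)) (s (e.obj j 0))) (dist (g (e.obj i 1)) (s (e.obj j 1)))

/-- A single arm can handle the first objects of all pairs and then the second objects. -/
lemma iInf_transitLength_le {m : ℕ} (e : Assignment m) (s g : Fin (2 * m) → Plane) {B D : ℝ}
    (hD : ∀ i j, dist (g i) (s j) ≤ D) (hD0 : 0 ≤ D)
    (h : HasOrdering (pairMoveCost e s g) Finset.univ B) :
    ⨅ σ : Equiv.Perm (Fin (2 * m)), transitLength s g σ ≤ 2 * B + D := by
  classical
  obtain ⟨l, h1, h2, h3⟩ := h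
  have hinj : ∀ k, Function.Injective fun i => e.obj i k := fun k i j hij =>
    (Prod.ext_iff.1 (Equiv.injective e hij)).1
  have hmem : ∀ i, i ∈ l := fun i => by rw [← List.mem_toFinset, h2]; exact Finset.mem_univ i
  obtain ⟨σ, hσ⟩ := exists_perm_orderCost_eq (c := fun i j => dist (g i) (s j))
    (l.map (fun i => e.obj i 0) ++ l.map (fun i => e.obj i 1))
    ((h1.map (hinj 0)).append (h1.map (hinj 1)) (by
      intro a ha hb
      obtain ⟨i, -, rfl⟩ := List.mem_map.1 ha
      obtain ⟨j, -, hj⟩ := List.mem_map.1 hb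
      exact absurd (Prod.ext_iff.1 (Equiv.injective e hj)).2 (by simp)))
    (fun a => by
      obtain ⟨⟨i, k⟩, rfl⟩ := Equiv.surjective e a
      rw [List.mem_append]
      fin_cases k
      · exact Or.inl (List.mem_map.2 ⟨i, hmem i, rfl⟩)
      · exact Or.inr (List.mem_map.2 ⟨i, hmem i, rfl⟩))
  have hle : transitLength s g σ ≤ 2 * B + D := by
    change orderCost (fun i j => dist (g i) (s j)) σ ≤ _
    rw [hσ]
    refine (pathCost_append_le hD hD0 _ _).trans ?_
    rw [pathCost_map, pathCost_map]
    have k0 := pathCost_mono (c := fun i j => dist (g (e.obj i 0)) (s (e.obj j 0)))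
      (c' := pairMoveCost e s g) (fun i j => le_max_left _ _) l
    have k1 := pathCost_mono (c := fun i j => dist (g (e.obj i 1)) (s (e.obj j 1)))
      (c' := pairMoveCost e s g) (fun i j => le_max_right _ _) l
    linarith
  exact (ciInf_le (Set.finite_range _).bddBelow σ).trans hle

lemma HasOrdering.exists_perm {n : ℕ} {c : Fin n → Fin n → ℝ} {B : ℝ}
    (h : HasOrdering c Finset.univ B) : ∃ σ : Equiv.Perm (Fin n), orderCost c σ ≤ B := by
  obtain ⟨l, h1, h2, h3⟩ := h
  obtain ⟨σ, hσ⟩ := exists_perm_orderCost_eq (c := c) l h1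
    (fun i => by rw [← List.mem_toFinset, h2]; exact Finset.mem_univ i)
  exact ⟨σ, hσ ▸ h3⟩

/-! ### The law of large numbers for the random pairs -/

/-- Families of variables formed from disjoint blocks of an independent family are independent. -/
lemma iIndepFun_curry {Ω ι κ E : Type*} [MeasurableSpace Ω] [MeasurableSpace E] {P : Measure Ω}
    [IsProbabilityMeasure P]
    {X : ι × κ → Ω → E} (mX : ∀ p, Measurable (X p)) (h : iIndepFun X P) :
    iIndepFun (fun i ω (j : κ) => X (i, j) ω) P := by
  have : ∀ i j, IsProbabilityMeasure (P.map (X (i, j))) :=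
    fun i j => Measure.isProbabilityMeasure_map (mX _).aemeasurable
  have hrow : ∀ i, P.map (fun ω j => X (i, j) ω)
      = Measure.infinitePi fun j => P.map (X (i, j)) := fun i =>
    (iIndepFun_iff_map_fun_eq_infinitePi_map (by fun_prop)).1
      (h.precomp (g := fun j => (i, j)) (fun _ _ h => (Prod.ext_iff.1 h).2))
  rw [iIndepFun_iff_map_fun_eq_infinitePi_map (by fun_prop)]
  simp only [hrow]
  -- Independence means that the joint law is a product measure, and currying turns the product over
  -- all index pairs into a product of the row laws.
  rw [← Measure.infinitePi_map_curry (fun i j => P.map (X (i, j))),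
    ← (iIndepFun_iff_map_fun_eq_infinitePi_map (by fun_prop)).1 h,
    Measure.map_map (by fun_prop) (by fun_prop)]
  rfl

/-- The joint distribution of the starts and goals `((s₁, g₁), (s₂, g₂))` of two objects. -/
noncomputable def pairLaw : Measure ((Plane × Plane) × (Plane × Plane)) :=
  (uniformSquare.prod uniformSquare).prod (uniformSquare.prod uniformSquare)

/-- The starts and goals of the `i`-th pair. -/
def pairPoints {m : ℕ} (e : Assignment m) (s g : Fin (2 * m) → Plane) (i : Fin m) :
    (Plane × Plane) × (Plane × Plane) :=
  ((s (e.obj i 0), g (e.obj i 0)), (s (e.obj i 1), g (e.obj i 1)))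

instance (m : ℕ) : DiscreteMeasurableSpace (Assignment m) := ⟨fun _ => trivial⟩

instance (m : ℕ) : Finite (Assignment m) :=
  inferInstanceAs (Finite ((Fin m × Fin 2) ≃ Fin (2 * m)))

section model

variable {Ω : Type*} [MeasurableSpace Ω] {P : Measure Ω} [IsProbabilityMeasure P]
  {start goal : ℕ → Ω → Plane} {split : ∀ m, Ω → Assignment m}

namespace IsRandomModel

omit [IsProbabilityMeasure P] in
lemma measurable_points (h : IsRandomModel P start goal split) (j : ℕ ⊕ ℕ) :
    Measurable (Sum.elim start goal j) := by
  cases j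
  · exact h.measurable_start _
  · exact h.measurable_goal _

lemma isProbabilityMeasure_uniformSquare (h : IsRandomModel P start goal split) :
    IsProbabilityMeasure uniformSquare := by
  rw [← h.map_start 0]
  exact Measure.isProbabilityMeasure_map (h.measurable_start 0).aemeasurable

omit [IsProbabilityMeasure P] in
lemma measurable_pairPoints (h : IsRandomModel P start goal split) {m : ℕ} (e : Assignment m)
    (i : Fin m) : Measurable fun ω =>
      pairPoints e (firstPoints start (2 * m) ω) (firstPoints goal (2 * m) ω) i :=
  ((h.measurable_start _).prodMk (h.measurable_goal _)).prodMk
    ((h.measurable_start _).prodMk (h.measurable_goal _))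

lemma map_start_goal (h : IsRandomModel P start goal split) (i : ℕ) :
    P.map (fun ω => (start i ω, goal i ω)) = uniformSquare.prod uniformSquare := by
  have hi : IndepFun (start i) (goal i) P :=
    h.indep_points.indepFun (i := Sum.inl i) (j := Sum.inr i) (by simp)
  rw [hi.map_prod_eq_prod_map_map (h.measurable_start i).aemeasurable
    (h.measurable_goal i).aemeasurable, h.map_start, h.map_goal]

lemma map_pairPoints (h : IsRandomModel P start goal split) {m : ℕ} (e : Assignment m)
    (i : Fin m) : P.map (fun ω =>
      pairPoints e (firstPoints start (2 * m) ω) (firstPoints goal (2 * m) ω) i) = pairLaw := by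
  have hne : (e.obj i 0 : ℕ) ≠ e.obj i 1 := fun h' => by
    simpa using Equiv.injective e (Fin.ext h')
  have hi := h.indep_points.indepFun_prodMk_prodMk h.measurable_points
    (.inl (e.obj i 0 : ℕ)) (.inr (e.obj i 0 : ℕ)) (.inl (e.obj i 1 : ℕ)) (.inr (e.obj i 1 : ℕ))
    (by simpa using hne) (by simp) (by simp) (by simpa using hne)
  have := hi.map_prod_eq_prod_map_map
    ((h.measurable_points _).prodMk (h.measurable_points _)).aemeasurable
    ((h.measurable_points _).prodMk (h.measurable_points _)).aemeasurable
  simp only [Sum.elim_inl, Sum.elim_inr, h.map_start_goal] at this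
  exact this

lemma iIndepFun_pairPoints (h : IsRandomModel P start goal split) {m : ℕ} (e : Assignment m) :
    iIndepFun (fun (i : Fin m) ω =>
      pairPoints e (firstPoints start (2 * m) ω) (firstPoints goal (2 * m) ω) i) P := by
  -- A point is addressed by its pair, its arm, and whether it is a start or a goal. Distinct
  -- addresses give distinct members of the independent family, so the pairs form disjoint blocks.
  have hinj : Function.Injective fun p : Fin m × (Fin 2 × Bool) =>
      if p.2.2 then (Sum.inl (e.obj p.1 p.2.1 : ℕ) : ℕ ⊕ ℕ)
      else Sum.inr (e.obj p.1 p.2.1 : ℕ) := by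
    rintro ⟨i, k, b⟩ ⟨j, l, b'⟩ hij
    have hobj : b = b' ∧ e.obj i k = e.obj j l := by
      cases b <;> cases b' <;> simp_all [Fin.ext_iff]
    have := Equiv.injective e hobj.2
    simp_all
  have hind := iIndepFun_curry (fun p => h.measurable_points _) (h.indep_points.precomp hinj)
  exact hind.comp (fun i x => ((x (0, true), x (0, false)), (x (1, true), x (1, false))))
    (fun i => by fun_prop)

/-- Hoeffding's inequality for a function of the pairs of a fixed assignment. -/
lemma measure_pairs_ge_le (h : IsRandomModel P start goal split) {m : ℕ} (e : Assignment m)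
    {f : (Plane × Plane) × (Plane × Plane) → ℝ} (hf : Measurable f) {B : ℝ}
    (hb : ∀ᵐ q ∂pairLaw, f q ∈ Icc 0 B) {ε : ℝ} (hε : 0 ≤ ε) :
    P.real {ω | m * ε ≤ ∑ i, (f (pairPoints e (firstPoints start (2 * m) ω)
      (firstPoints goal (2 * m) ω) i) - ∫ q, f q ∂pairLaw)} ≤
      Real.exp (-(m * ε) ^ 2 / (2 * (m * (|B| / 2) ^ 2))) := by
  have hint : ∀ i, ∫ ω, f (pairPoints e (firstPoints start (2 * m) ω)
      (firstPoints goal (2 * m) ω) i) ∂P = ∫ q, f q ∂pairLaw := fun i => by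
    rw [← h.map_pairPoints e i, integral_map (h.measurable_pairPoints e i).aemeasurable
      hf.aestronglyMeasurable]
  have hsub : ∀ i ∈ Finset.univ, HasSubgaussianMGF (fun ω => f (pairPoints e
      (firstPoints start (2 * m) ω) (firstPoints goal (2 * m) ω) i) - ∫ q, f q ∂pairLaw)
      ((‖B - 0‖₊ / 2) ^ 2) P := fun i _ => by
    rw [← hint i]
    refine hasSubgaussianMGF_of_mem_Icc (hf.comp (h.measurable_pairPoints e i)).aemeasurable ?_
    rw [← h.map_pairPoints e i] at hb
    exact ae_of_ae_map (h.measurable_pairPoints e i).aemeasurable hb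
  have := HasSubgaussianMGF.measure_sum_ge_le_of_iIndepFun ((h.iIndepFun_pairPoints e).comp
    (fun _ q => f q - ∫ q, f q ∂pairLaw) (fun _ => hf.sub_const _))
    hsub (ε := m * ε) (by positivity)
  simpa using this

/-- A bound for events which depend on the random pairs. -/
lemma measure_split_le (h : IsRandomModel P start goal split) {m : ℕ}
    {A : Assignment m → Set (ℕ ⊕ ℕ → Plane)} (hA : ∀ e, MeasurableSet (A e)) {δ : ℝ≥0∞}
    (hδ : ∀ e, P {ω | (fun j => Sum.elim start goal j ω) ∈ A e} ≤ δ) :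
    P {ω | (fun j => Sum.elim start goal j ω) ∈ A (split m ω)} ≤ δ := by
  have := Fintype.ofFinite (Assignment m)
  calc P {ω | (fun j => Sum.elim start goal j ω) ∈ A (split m ω)}
      ≤ P (⋃ e, split m ⁻¹' {e} ∩ (fun ω j => Sum.elim start goal j ω) ⁻¹' A e) := by
        refine measure_mono fun ω hω => mem_iUnion.2 ⟨split m ω, rfl, hω⟩
    _ ≤ ∑ e, P (split m ⁻¹' {e} ∩ (fun ω j => Sum.elim start goal j ω) ⁻¹' A e) :=
        measure_iUnion_fintype_le _ _
    _ ≤ ∑ e, P (split m ⁻¹' {e}) * δ := by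
        refine Finset.sum_le_sum fun e _ => ?_
        rw [(h.indep_split m).measure_inter_preimage_eq_mul _ _ (measurableSet_singleton e) (hA e)]
        gcongr
        exact hδ e
    _ = δ := by
        rw [← Finset.sum_mul, sum_measure_preimage_singleton _
          (fun e _ => h.measurable_split m (measurableSet_singleton e))]
        simp

/-- The average of a bounded function over the random pairs tends to its expectation. -/
theorem tendsto_pair_average (h : IsRandomModel P start goal split)
    {f : (Plane × Plane) × (Plane × Plane) → ℝ} (hf : Measurable f) {B : ℝ}
    (hb : ∀ᵐ q ∂pairLaw, f q ∈ Icc 0 B) :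
    ∀ᵐ ω ∂P, Tendsto (fun m : ℕ => (∑ i, f (pairPoints (split m ω) (firstPoints start (2 * m) ω)
      (firstPoints goal (2 * m) ω) i)) / m) atTop (nhds (∫ q, f q ∂pairLaw)) := by
  set μ := ∫ q, f q ∂pairLaw with hμ
  -- The exponential rate divides by `B`; a bound that is not positive can be replaced by 1.
  wlog hB : 0 < B generalizing B
  · exact this (B := 1) (hb.mono fun q hq => ⟨hq.1, hq.2.trans (by linarith)⟩) one_pos
  -- The upper tail bound applied to `B - f` gives the lower tail for `f`.
  have hb' : ∀ᵐ q ∂pairLaw, B - f q ∈ Icc 0 B :=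
    hb.mono fun q hq => ⟨by linarith [hq.2], by linarith [hq.1]⟩
  have := h.isProbabilityMeasure_uniformSquare
  have : IsProbabilityMeasure pairLaw := by unfold pairLaw; infer_instance
  have hμ' : ∫ q, (B - f q) ∂pairLaw = B - μ := by
    rw [integral_sub (integrable_const _) (Integrable.of_mem_Icc 0 B hf.aemeasurable hb)]
    simp [hμ]
  have key : ∀ ε : ℝ, 0 < ε → ∀ᵐ ω ∂P, ∀ᶠ m : ℕ in atTop,
      |∑ i, (f (pairPoints (split m ω) (firstPoints start (2 * m) ω)
        (firstPoints goal (2 * m) ω) i) - μ)| < m * ε := by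
    intro ε hε
    set q : ℝ := ε ^ 2 / (2 * (B / 2) ^ 2) with hq
    have hq0 : 0 < q := by positivity
    have hbound : ∀ m, P {ω | ¬ |∑ i, (f (pairPoints (split m ω) (firstPoints start (2 * m) ω)
        (firstPoints goal (2 * m) ω) i) - μ)| < m * ε}
        ≤ ENNReal.ofReal (2 * Real.exp (-q) ^ m) := by
      intro m
      rcases Nat.eq_zero_or_pos m with rfl | hm
      · exact prob_le_one.trans (by norm_num)
      have hm' : (0 : ℝ) < m := by exact_mod_cast hm
      have hexp : Real.exp (-(m * ε) ^ 2 / (2 * (m * (|B| / 2) ^ 2))) = Real.exp (-q) ^ m := by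
        rw [← Real.exp_nat_mul, abs_of_pos hB, hq]
        congr 1
        field_simp
      let pts (e : Assignment m) (z : ℕ ⊕ ℕ → Plane) (i : Fin m) :=
        pairPoints e (fun j => z (.inl j)) (fun j => z (.inr j)) i
      have hpts : ∀ e i, Measurable fun z => pts e z i := fun e i => by
        simp only [pts, pairPoints]; fun_prop
      refine h.measure_split_le (A := fun e => {z | ¬ |∑ i, (f (pts e z i) - μ)| < m * ε})
        (fun e => ?_) (fun e => ?_)
      · refine (measurableSet_lt (Measurable.norm (α := ℝ) ?_) measurable_const).compl
        exact Finset.measurable_sum _ fun i _ => (hf.comp (hpts e i)).sub_const _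
      · have h1 := h.measure_pairs_ge_le e hf hb hε.le
        have h2 := h.measure_pairs_ge_le e (hf.const_sub B) hb' hε.le
        rw [hexp] at h1 h2
        rw [← ENNReal.ofReal_toReal (measure_ne_top P _)]
        refine ENNReal.ofReal_le_ofReal ?_
        refine (measureReal_mono (fun ω hω => ?_)).trans
          ((measureReal_union_le _ _).trans (add_le_add h1 h2) |>.trans (by rw [two_mul]))
        simp only [mem_ofPred_eq, not_lt, le_abs] at hω
        refine hω.imp (fun h => h) (fun h => ?_)
        simp only [mem_ofPred_eq, hμ']
        refine h.trans (le_of_eq ?_)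
        rw [← Finset.sum_neg_distrib]
        refine Finset.sum_congr rfl fun i _ => ?_
        simp only [pts, pairPoints, firstPoints, Sum.elim_inl, Sum.elim_inr]
        ring
    -- The failure probabilities are dominated by a geometric series, so Borel–Cantelli applies
    -- without any relation between the splits for different `m`.
    have hsum : ∑' m : ℕ, P {ω | ¬ |∑ i, (f (pairPoints (split m ω)
        (firstPoints start (2 * m) ω) (firstPoints goal (2 * m) ω) i) - μ)| < m * ε} ≠ ⊤ := by
      refine ne_top_of_le_ne_top ?_ (ENNReal.tsum_le_tsum hbound)
      refine Summable.tsum_ofReal_ne_top ?_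
      exact (summable_geometric_of_lt_one (Real.exp_nonneg _)
        (Real.exp_lt_one_iff.2 (by linarith))).mul_left 2
    filter_upwards [ae_eventually_notMem hsum] with ω hω
    filter_upwards [hω] with m hm
    simpa using hm
  have key' := ae_all_iff.2 fun k : ℕ => key (1 / (k + 1)) (by positivity)
  filter_upwards [key'] with ω hω
  rw [Metric.tendsto_nhds]
  intro ε hε
  obtain ⟨k, hk⟩ := exists_nat_one_div_lt hε
  filter_upwards [hω k, eventually_gt_atTop 0] with m hm hm0
  have hm' : (0 : ℝ) < m := by exact_mod_cast hm0
  rw [Finset.sum_sub_distrib] at hm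
  simp only [Finset.sum_const, Finset.card_univ, Fintype.card_fin, nsmul_eq_mul] at hm
  rw [Real.dist_eq, show ∀ a : ℝ, a / m - μ = (a - m * μ) / m by intro a; field_simp, abs_div,
    abs_of_pos hm', div_lt_iff₀ hm', mul_comm ε]
  exact hm.trans (by gcongr)

end IsRandomModel

end model

/-! ### The distribution of the length of a transfer -/

/-- The distribution of the distance of two independent uniform points of the unit interval. -/
noncomputable def triangleLaw : Measure ℝ :=
  (volume.restrict (Icc 0 1)).withDensity fun u => ENNReal.ofReal (2 * (1 - u))

lemma volume_inter_shift (u : ℝ) :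
    volume (Icc (0 : ℝ) 1 ∩ (fun x => u + x) ⁻¹' Icc 0 1) = ENNReal.ofReal (1 - |u|) := by
  have : Icc (0 : ℝ) 1 ∩ (fun x => u + x) ⁻¹' Icc 0 1 = Icc (max 0 (-u)) (min 1 (1 - u)) := by
    ext x
    simp only [mem_inter_iff, mem_preimage, mem_Icc, max_le_iff, le_min_iff]
    constructor
    · rintro ⟨⟨h1, h2⟩, h3, h4⟩
      exact ⟨⟨h1, by linarith⟩, h2, by linarith⟩
    · rintro ⟨⟨h1, h2⟩, h3, h4⟩
      exact ⟨⟨h1, h3⟩, by linarith, by linarith⟩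
  rw [this, Real.volume_Icc]
  congr 1
  rcases le_total 0 u with h | h
  · rw [abs_of_nonneg h, max_eq_left (by linarith), min_eq_right (by linarith), sub_zero]
  · rw [abs_of_nonpos h, max_eq_right (by linarith), min_eq_left (by linarith)]

lemma lintegral_even {k : ℝ → ℝ≥0∞} (hk : ∀ x, k (-x) = k x) :
    ∫⁻ x, k x = 2 * ∫⁻ x in Ici 0, k x := by
  have h1 : ∫⁻ x in Iio 0, k x = ∫⁻ x in Ici 0, k x := by
    rw [setLIntegral_congr Ioi_ae_eq_Ici.symm,
      ← (Measure.measurePreserving_neg (volume : Measure ℝ)).setLIntegral_comp_preimage_emb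
        (MeasurableEquiv.neg ℝ).measurableEmbedding k (Ioi 0)]
    simp [hk]
  rw [← lintegral_add_compl k (measurableSet_Ici (a := (0 : ℝ))), compl_Ici, h1, two_mul]

/-- After the substitution `x = u + y`, the inner integral measures the `y` for which both points
lie in the interval. This gives the density `1 - |u|` of the signed difference; folding at 0 doubles
it. -/
lemma map_abs_sub_eq_triangleLaw :
    ((volume.restrict (Icc (0 : ℝ) 1)).prod (volume.restrict (Icc (0 : ℝ) 1))).map
      (fun p => |p.1 - p.2|) = triangleLaw := by
  refine Measure.ext_of_lintegral _ fun k hk => ?_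
  have hm : Measurable fun p : ℝ × ℝ => |p.1 - p.2| :=
    (measurable_fst.sub measurable_snd).norm
  rw [lintegral_map hk hm, lintegral_prod_symm' (fun p : ℝ × ℝ => k |p.1 - p.2|) (hk.comp hm), triangleLaw,
    lintegral_withDensity_eq_lintegral_mul _ (by fun_prop) hk]
  set I := Icc (0 : ℝ) 1 with hI
  have hImeas : MeasurableSet I := measurableSet_Icc
  have hkabs : Measurable fun u : ℝ => k |u| := hk.comp measurable_norm
  calc ∫⁻ y in I, ∫⁻ x in I, k |x - y|
      = ∫⁻ y in I, ∫⁻ u, I.indicator 1 (u + y) * k |u| := by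
        refine lintegral_congr fun y => ?_
        rw [← lintegral_indicator hImeas,
          ← lintegral_add_right_eq_self (fun x => I.indicator (fun x => k |x - y|) x) y]
        refine lintegral_congr fun u => ?_
        by_cases h : u + y ∈ I <;> simp [h]
    _ = ∫⁻ u, ∫⁻ y in I, I.indicator 1 (u + y) * k |u| := by
        refine lintegral_lintegral_swap (Measurable.aemeasurable ?_)
        refine Measurable.mul ?_ (hkabs.comp measurable_snd)
        exact (measurable_one.indicator hImeas).comp (measurable_snd.add measurable_fst)
    _ = ∫⁻ u, ENNReal.ofReal (1 - |u|) * k |u| := by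
        refine lintegral_congr fun u => ?_
        have hs : MeasurableSet ((fun x => u + x) ⁻¹' I) := measurableSet_preimage (by fun_prop) hImeas
        have hi : Measurable fun y : ℝ => I.indicator (1 : ℝ → ℝ≥0∞) (u + y) :=
          (measurable_one.indicator hImeas).comp (by fun_prop)
        rw [lintegral_mul_const _ hi]
        congr 1
        rw [← volume_inter_shift, inter_comm, ← Measure.restrict_apply hs,
          ← lintegral_indicator_one hs]
        rfl
    _ = 2 * ∫⁻ u in Ici 0, ENNReal.ofReal (1 - |u|) * k |u| := lintegral_even (by simp)
    _ = 2 * ∫⁻ u in I, ENNReal.ofReal (1 - u) * k u := by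
        congr 1
        rw [← lintegral_indicator hImeas, ← lintegral_indicator measurableSet_Ici]
        refine lintegral_congr fun u => ?_
        by_cases h0 : 0 ≤ u
        · by_cases h1 : u ≤ 1
          · rw [indicator_of_mem (show u ∈ Ici 0 from h0), indicator_of_mem (show u ∈ I from ⟨h0, h1⟩),
              abs_of_nonneg h0]
          · rw [indicator_of_mem (show u ∈ Ici 0 from h0),
              indicator_of_notMem (fun h : u ∈ I => h1 h.2),
              ENNReal.ofReal_of_nonpos (by rw [abs_of_nonneg h0]; linarith), zero_mul]
        · rw [indicator_of_notMem (by simpa using h0), indicator_of_notMem (fun h => h0 h.1)]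
    _ = _ := by
        rw [← lintegral_const_mul _ (by fun_prop)]
        refine lintegral_congr fun u => ?_
        rw [Pi.mul_apply, ENNReal.ofReal_mul zero_le_two, ← mul_assoc, ENNReal.ofReal_ofNat]

instance : IsProbabilityMeasure (volume.restrict (Icc (0 : ℝ) 1)) :=
  ⟨by simp⟩

instance : IsProbabilityMeasure triangleLaw := by
  rw [← map_abs_sub_eq_triangleLaw]
  exact Measure.isProbabilityMeasure_map
    (measurable_fst.sub measurable_snd).norm.aemeasurable

/-- The point of the plane with given coordinates. -/
noncomputable def planePoint : ℝ × ℝ ≃ᵐ Plane :=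
  MeasurableEquiv.finTwoArrow.symm.trans (MeasurableEquiv.toLp 2 (Fin 2 → ℝ))

lemma planePoint_zero (p : ℝ × ℝ) : planePoint p 0 = p.1 := rfl

lemma planePoint_one (p : ℝ × ℝ) : planePoint p 1 = p.2 := rfl

lemma uniformSquare_eq_map :
    uniformSquare = ((volume.restrict (Icc (0 : ℝ) 1)).prod (volume.restrict (Icc (0 : ℝ) 1))).map
      planePoint := by
  have hp : MeasurePreserving planePoint volume volume :=
    (volume_preserving_finTwoArrow ℝ).symm.trans
      (EuclideanSpace.volume_preserving_symm_measurableEquiv_toLp (Fin 2)).symm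
  have hpre : planePoint ⁻¹' unitSquare = Icc (0 : ℝ) 1 ×ˢ Icc (0 : ℝ) 1 := by
    ext p
    simp only [unitSquare, mem_preimage, mem_ofPred_eq, Fin.forall_fin_two, planePoint_zero,
      planePoint_one, mem_prod]
  have hr : ((volume.restrict (Icc (0 : ℝ) 1)).prod (volume.restrict (Icc (0 : ℝ) 1))).map
      planePoint = volume.restrict unitSquare := by
    rw [Measure.prod_restrict, ← hpre]
    exact (hp.restrict_preimage_emb planePoint.measurableEmbedding unitSquare).map_eq
  have hone : volume unitSquare = 1 := by
    rw [← Measure.restrict_apply_univ, ← hr, Measure.map_apply planePoint.measurable .univ]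
    simp
  rw [uniformSquare, ProbabilityTheory.cond, hone, inv_one, one_smul, hr]

instance : IsProbabilityMeasure uniformSquare := by
  rw [uniformSquare_eq_map]
  exact Measure.isProbabilityMeasure_map planePoint.measurable.aemeasurable

/-- The distribution of the length of a transfer. -/
noncomputable def lengthLaw : Measure ℝ :=
  (triangleLaw.prod triangleLaw).map fun p => √(p.1 ^ 2 + p.2 ^ 2)

lemma map_dist_eq_lengthLaw :
    (uniformSquare.prod uniformSquare).map (fun p : Plane × Plane => dist p.1 p.2) = lengthLaw := by
  refine Measure.ext_of_lintegral _ fun k hk => ?_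
  have hmd : Measurable fun p : Plane × Plane => dist p.1 p.2 := by fun_prop
  set K : ℝ × ℝ → ℝ≥0∞ := fun p => k √(p.1 ^ 2 + p.2 ^ 2) with hK
  have hKm : Measurable K := hk.comp (by fun_prop)
  have habs : ∀ {α : Type} [MeasurableSpace α] {f g : α → ℝ}, Measurable f → Measurable g →
      Measurable fun a => |f a - g a| := fun hf hg => (hf.sub hg).norm
  have hdist : ∀ p q : ℝ × ℝ, k (dist (planePoint p) (planePoint q))
      = K (|p.1 - q.1|, |p.2 - q.2|) := fun p q => by
    simp [hK, EuclideanSpace.dist_eq, Fin.sum_univ_two, planePoint_zero, planePoint_one,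
      Real.dist_eq]
  rw [lintegral_map hk hmd, lengthLaw, lintegral_map hk (by fun_prop),
    lintegral_prod (fun p : Plane × Plane => k (dist p.1 p.2)) (hk.comp hmd).aemeasurable, uniformSquare_eq_map]
  set μ := volume.restrict (Icc (0 : ℝ) 1) with hμ
  have hΦ : ∀ (a : ℝ), ∫⁻ y, ∫⁻ y', K (a, |y - y'|) ∂μ ∂μ = ∫⁻ v, K (a, v) ∂triangleLaw := by
    intro a
    rw [← map_abs_sub_eq_triangleLaw, lintegral_map (by fun_prop)
      (habs measurable_fst measurable_snd), lintegral_prod]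
    exact (hKm.comp (measurable_const.prodMk (habs measurable_fst measurable_snd))).aemeasurable
  have hKv : Measurable fun u => ∫⁻ v, K (u, v) ∂triangleLaw := hKm.lintegral_prod_right'
  calc ∫⁻ x, ∫⁻ y, k (dist x y) ∂(μ.prod μ).map planePoint ∂(μ.prod μ).map planePoint
      = ∫⁻ p, ∫⁻ q, K (|p.1 - q.1|, |p.2 - q.2|) ∂μ.prod μ ∂μ.prod μ := by
        rw [MeasureTheory.lintegral_map_equiv]
        refine lintegral_congr fun p => ?_
        rw [MeasureTheory.lintegral_map_equiv]
        exact lintegral_congr fun q => hdist p q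
    _ = ∫⁻ x, ∫⁻ y, ∫⁻ x', ∫⁻ y', K (|x - x'|, |y - y'|) ∂μ ∂μ ∂μ ∂μ := by
        rw [lintegral_prod]
        · refine lintegral_congr fun x => lintegral_congr fun y => ?_
          rw [lintegral_prod]
          exact (hKm.comp ((habs measurable_const measurable_fst).prodMk
            (habs measurable_const measurable_snd))).aemeasurable
        · refine Measurable.aemeasurable (Measurable.lintegral_prod_right' (f := fun z :
            (ℝ × ℝ) × (ℝ × ℝ) => K (|z.1.1 - z.2.1|, |z.1.2 - z.2.2|)) (hKm.comp ?_))
          exact (habs (by fun_prop) (by fun_prop)).prodMk (habs (by fun_prop) (by fun_prop))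
    -- Regrouping by coordinates instead of by points exhibits the two coordinate differences as
    -- independent.
    _ = ∫⁻ x, ∫⁻ x', ∫⁻ y, ∫⁻ y', K (|x - x'|, |y - y'|) ∂μ ∂μ ∂μ ∂μ := by
        refine lintegral_congr fun x => lintegral_lintegral_swap (Measurable.aemeasurable ?_)
        refine Measurable.lintegral_prod_right' (f := fun z :
            (ℝ × ℝ) × ℝ => K (|x - z.1.2|, |z.1.1 - z.2|)) (hKm.comp ?_)
        exact (habs (by fun_prop) (by fun_prop)).prodMk (habs (by fun_prop) (by fun_prop))
    _ = ∫⁻ x, ∫⁻ x', (fun u => ∫⁻ v, K (u, v) ∂triangleLaw) |x - x'| ∂μ ∂μ := by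
        simp only [hΦ]
    _ = ∫⁻ u, ∫⁻ v, K (u, v) ∂triangleLaw ∂triangleLaw := by
        conv_rhs => rw [← map_abs_sub_eq_triangleLaw]
        rw [lintegral_map (by rw [map_abs_sub_eq_triangleLaw]; exact hKv)
          (habs measurable_fst measurable_snd), lintegral_prod,
          map_abs_sub_eq_triangleLaw]
        rw [map_abs_sub_eq_triangleLaw]
        exact (hKv.comp (habs measurable_fst measurable_snd)).aemeasurable
    _ = _ := by rw [lintegral_prod _ hKm.aemeasurable]

instance : IsProbabilityMeasure lengthLaw :=
  Measure.isProbabilityMeasure_map (by fun_prop)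

/-! ### The distribution function of the length of a transfer -/

lemma integral_triangleLaw (f : ℝ → ℝ) :
    ∫ u, f u ∂triangleLaw = ∫ u in (0 : ℝ)..1, 2 * (1 - u) * f u := by
  rw [triangleLaw, integral_withDensity_eq_integral_toReal_smul (by fun_prop)
    (ae_of_all _ fun _ => ENNReal.ofReal_lt_top), intervalIntegral.integral_of_le zero_le_one,
    integral_Icc_eq_integral_Ioc]
  refine setIntegral_congr_fun measurableSet_Ioc fun u hu => ?_
  simp only [smul_eq_mul]
  rw [ENNReal.toReal_ofReal (by linarith [hu.2])]

lemma ae_triangleLaw_mem_Icc : ∀ᵐ u ∂triangleLaw, u ∈ Icc (0 : ℝ) 1 :=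
  (withDensity_absolutelyContinuous _ _).ae_le (ae_restrict_mem measurableSet_Icc)

/-- For negative `a` the event is empty and `√a = 0`, so one formula also covers the case in which
the other coordinate alone exceeds the radius. -/
lemma triangleLaw_real_sq_le {a : ℝ} (ha : a ≤ 1) :
    triangleLaw.real {v | v ^ 2 ≤ a} = 2 * √a - √a ^ 2 := by
  rcases lt_or_ge a 0 with h | h
  · have : {v : ℝ | v ^ 2 ≤ a} = ∅ := by
      ext v; simp only [mem_ofPred_eq, mem_empty_iff_false, iff_false, not_le]
      exact h.trans_le (sq_nonneg v)
    rw [this, Real.sqrt_eq_zero_of_nonpos h.le]; simp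
  have hs1 : √a ≤ 1 := Real.sqrt_le_one.2 ha
  have hm : MeasurableSet {v : ℝ | v ^ 2 ≤ a} := measurableSet_le (by fun_prop) measurable_const
  rw [← integral_indicator_one hm, integral_triangleLaw]
  have hsplit : ∫ u in (0 : ℝ)..1, 2 * (1 - u) * {v : ℝ | v ^ 2 ≤ a}.indicator 1 u
      = ∫ u in (0 : ℝ)..√a, 2 * (1 - u) := by
    rw [intervalIntegral.integral_of_le zero_le_one,
      intervalIntegral.integral_of_le (Real.sqrt_nonneg a),
      ← integral_indicator measurableSet_Ioc, ← integral_indicator measurableSet_Ioc]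
    congr 1
    ext u
    by_cases hu : u ∈ Ioc 0 √a
    · have h2 : u ∈ {v : ℝ | v ^ 2 ≤ a} := (Real.le_sqrt hu.1.le h).1 hu.2
      rw [indicator_of_mem hu, indicator_of_mem (show u ∈ Ioc 0 1 from ⟨hu.1, hu.2.trans hs1⟩),
        indicator_of_mem h2]
      simp
    · rw [indicator_of_notMem hu]
      by_cases h1 : u ∈ Ioc (0 : ℝ) 1
      · have h2 : u ∉ {v : ℝ | v ^ 2 ≤ a} := fun h2 => hu ⟨h1.1, (Real.le_sqrt h1.1.le h).2 h2⟩
        rw [indicator_of_mem h1, indicator_of_notMem h2, mul_zero]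
      · rw [indicator_of_notMem h1]
  rw [hsplit]
  have : ∀ u ∈ uIcc 0 √a, HasDerivAt (fun u : ℝ => 2 * u - u ^ 2) (2 * (1 - u)) u := fun u _ => by
    have := ((hasDerivAt_id u).const_mul 2).sub (hasDerivAt_pow 2 u)
    refine this.congr_deriv ?_
    simp; ring
  rw [intervalIntegral.integral_eq_sub_of_hasDerivAt this
    (Continuous.intervalIntegrable (by fun_prop) _ _)]
  ring

lemma integral_sqrt_sq_sub_sq {t : ℝ} (ht : 0 ≤ t) :
    ∫ u in (0 : ℝ)..t, √(t ^ 2 - u ^ 2) = Real.pi * t ^ 2 / 4 := by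
  have hq : ∫ x in (0 : ℝ)..1, √(1 - x ^ 2) = Real.pi / 4 := by
    have h := integral_sqrt_one_sub_sq
    rw [← intervalIntegral.integral_add_adjacent_intervals (b := 0)
      (Continuous.intervalIntegrable (by fun_prop) _ _)
      (Continuous.intervalIntegrable (by fun_prop) _ _)] at h
    have h2 := intervalIntegral.integral_comp_neg (a := -1) (b := 0) (fun x : ℝ => √(1 - x ^ 2))
    simp only [neg_sq, neg_zero, neg_neg] at h2
    linarith
  have h := intervalIntegral.mul_integral_comp_mul_left (a := 0) (b := 1)
    (f := fun u : ℝ => √(t ^ 2 - u ^ 2)) (c := t)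
  simp only [mul_zero, mul_one] at h
  rw [← h]
  have : ∀ x : ℝ, √(t ^ 2 - (t * x) ^ 2) = t * √(1 - x ^ 2) := fun x => by
    rw [show t ^ 2 - (t * x) ^ 2 = t ^ 2 * (1 - x ^ 2) by ring, Real.sqrt_mul (sq_nonneg t),
      Real.sqrt_sq ht]
  simp only [this, intervalIntegral.integral_const_mul, hq]
  ring

lemma integral_mul_sqrt_sq_sub_sq {t : ℝ} (ht : 0 ≤ t) :
    ∫ u in (0 : ℝ)..t, u * √(t ^ 2 - u ^ 2) = t ^ 3 / 3 := by
  have h := intervalIntegral.integral_eq_sub_of_hasDerivAt_of_le ht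
    (f := fun u : ℝ => -((t ^ 2 - u ^ 2) * √(t ^ 2 - u ^ 2)) / 3)
    (f' := fun u => u * √(t ^ 2 - u ^ 2)) (Continuous.continuousOn (by fun_prop))
    (fun u hu => ?_) (Continuous.intervalIntegrable (by fun_prop) _ _)
  · rw [h, sub_self, zero_mul, neg_zero, zero_div]
    simp only [ne_eq, OfNat.ofNat_ne_zero, not_false_eq_true, zero_pow, sub_zero]
    rw [Real.sqrt_sq ht]; ring
  · have hpos : 0 < t ^ 2 - u ^ 2 := by nlinarith [hu.1, hu.2]
    have h1 : HasDerivAt (fun u : ℝ => t ^ 2 - u ^ 2) (-(2 * u)) u := by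
      have := (hasDerivAt_pow 2 u).const_sub (t ^ 2)
      simpa using this
    refine ((h1.mul (h1.sqrt hpos.ne')).neg.div_const 3).congr_deriv ?_
    have hsq := Real.sq_sqrt hpos.le
    have hs0 : √(t ^ 2 - u ^ 2) ≠ 0 := (Real.sqrt_pos.2 hpos).ne'
    field_simp
    rw [hsq]; ring

/-- The probability that a transfer has length at most `t`, for `t ≤ 1`. -/
theorem lengthLaw_real_Iic {t : ℝ} (ht : 0 ≤ t) (ht1 : t ≤ 1) :
    lengthLaw.real (Iic t) = Real.pi * t ^ 2 - 8 / 3 * t ^ 3 + t ^ 4 / 2 := by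
  have hm : MeasurableSet {p : ℝ × ℝ | p.2 ^ 2 ≤ t ^ 2 - p.1 ^ 2} :=
    measurableSet_le (by fun_prop) (by fun_prop)
  have hpre : (fun p : ℝ × ℝ => √(p.1 ^ 2 + p.2 ^ 2)) ⁻¹' Iic t
      = {p : ℝ × ℝ | p.2 ^ 2 ≤ t ^ 2 - p.1 ^ 2} := by
    ext p
    simp only [mem_preimage, mem_Iic, mem_ofPred_eq, Real.sqrt_le_left ht]
    constructor <;> intro h <;> linarith
  rw [lengthLaw, map_measureReal_apply (by fun_prop) measurableSet_Iic, hpre,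
    ← integral_indicator_one hm, integral_prod
      ({p : ℝ × ℝ | p.2 ^ 2 ≤ t ^ 2 - p.1 ^ 2}.indicator 1)
      ((integrable_const (1 : ℝ)).indicator hm)]
  have hin : ∀ u : ℝ, ∫ v, {p : ℝ × ℝ | p.2 ^ 2 ≤ t ^ 2 - p.1 ^ 2}.indicator (1 : ℝ × ℝ → ℝ) (u, v)
      ∂triangleLaw = 2 * √(t ^ 2 - u ^ 2) - √(t ^ 2 - u ^ 2) ^ 2 := fun u => by
    rw [← triangleLaw_real_sq_le (by nlinarith [sq_nonneg u]), ← integral_indicator_one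
      (measurableSet_le (by fun_prop) measurable_const)]
    rfl
  simp only [hin]
  rw [integral_triangleLaw, ← intervalIntegral.integral_add_adjacent_intervals (b := t)
      (Continuous.intervalIntegrable (by fun_prop) _ _)
      (Continuous.intervalIntegrable (by fun_prop) _ _)]
  -- Beyond `t` the radicand is not positive, and the real square root is 0 there.
  have hzero : ∫ u in t..1, 2 * (1 - u) * (2 * √(t ^ 2 - u ^ 2) - √(t ^ 2 - u ^ 2) ^ 2) = 0 := by
    rw [intervalIntegral.integral_congr (g := fun _ => (0 : ℝ))]
    · simp
    · intro u hu
      rw [uIcc_of_le ht1] at hu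
      simp only
      rw [Real.sqrt_eq_zero_of_nonpos (by nlinarith [hu.1])]; simp
  have hmain : ∫ u in (0 : ℝ)..t, 2 * (1 - u) * (2 * √(t ^ 2 - u ^ 2) - √(t ^ 2 - u ^ 2) ^ 2)
      = ∫ u in (0 : ℝ)..t, (4 * √(t ^ 2 - u ^ 2) - 4 * (u * √(t ^ 2 - u ^ 2))
        - (2 * t ^ 2 - 2 * t ^ 2 * u - 2 * u ^ 2 + 2 * u ^ 3)) := by
    refine intervalIntegral.integral_congr fun u hu => ?_
    rw [uIcc_of_le ht] at hu
    rw [Real.sq_sqrt (by nlinarith [hu.1, hu.2])]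
    ring
  have hpoly : ∫ u in (0 : ℝ)..t, (2 * t ^ 2 - 2 * t ^ 2 * u - 2 * u ^ 2 + 2 * u ^ 3)
      = 4 / 3 * t ^ 3 - t ^ 4 / 2 := by
    have : ∀ u ∈ uIcc 0 t, HasDerivAt
        (fun u : ℝ => 2 * t ^ 2 * u - t ^ 2 * u ^ 2 - 2 / 3 * u ^ 3 + 1 / 2 * u ^ 4)
        (2 * t ^ 2 - 2 * t ^ 2 * u - 2 * u ^ 2 + 2 * u ^ 3) u := fun u _ => by
      have := ((((hasDerivAt_id u).const_mul (2 * t ^ 2)).sub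
        ((hasDerivAt_pow 2 u).const_mul (t ^ 2))).sub
        ((hasDerivAt_pow 3 u).const_mul (2 / 3))).add ((hasDerivAt_pow 4 u).const_mul (1 / 2))
      refine this.congr_deriv ?_
      norm_num
      ring
    rw [intervalIntegral.integral_eq_sub_of_hasDerivAt this
      (Continuous.intervalIntegrable (by fun_prop) _ _)]
    ring
  rw [hzero, hmain, intervalIntegral.integral_sub, intervalIntegral.integral_sub,
    intervalIntegral.integral_const_mul, intervalIntegral.integral_const_mul,
    integral_sqrt_sq_sub_sq ht, integral_mul_sqrt_sq_sub_sq ht, hpoly]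
  · ring
  all_goals exact Continuous.intervalIntegrable (by fun_prop) _ _

lemma ae_lengthLaw_mem_Icc : ∀ᵐ t ∂lengthLaw, t ∈ Icc 0 √2 := by
  have h : ∀ᵐ p ∂triangleLaw.prod triangleLaw, p.1 ∈ Icc (0 : ℝ) 1 ∧ p.2 ∈ Icc (0 : ℝ) 1 :=
    (Measure.quasiMeasurePreserving_fst.ae ae_triangleLaw_mem_Icc).and
      (Measure.quasiMeasurePreserving_snd.ae ae_triangleLaw_mem_Icc)
  rw [lengthLaw]
  refine (ae_map_iff (p := fun t => t ∈ Icc 0 √2) (by fun_prop) measurableSet_Icc).2 ?_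
  filter_upwards [h] with p hp
  refine ⟨Real.sqrt_nonneg _, Real.sqrt_le_sqrt ?_⟩
  nlinarith [hp.1.1, hp.1.2, hp.2.1, hp.2.2]

lemma integral_sq_lengthLaw : ∫ t, t ^ 2 ∂lengthLaw = 1 / 3 := by
  have hsq : ∫ u, u ^ 2 ∂triangleLaw = 1 / 6 := by
    rw [integral_triangleLaw]
    have : ∀ u ∈ uIcc (0 : ℝ) 1, HasDerivAt
        (fun u : ℝ => 2 / 3 * u ^ 3 - 1 / 2 * u ^ 4) (2 * (1 - u) * u ^ 2) u := fun u _ => by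
      have := ((hasDerivAt_pow 3 u).const_mul (2 / 3)).sub ((hasDerivAt_pow 4 u).const_mul (1 / 2))
      refine this.congr_deriv ?_
      norm_num
      ring
    rw [intervalIntegral.integral_eq_sub_of_hasDerivAt this
      (Continuous.intervalIntegrable (by fun_prop) _ _)]
    norm_num
  have hint : Integrable (fun u : ℝ => u ^ 2) triangleLaw := by
    refine Integrable.of_mem_Icc 0 1 (by fun_prop) ?_
    filter_upwards [ae_triangleLaw_mem_Icc] with u hu
    exact ⟨sq_nonneg u, pow_le_one₀ hu.1 hu.2⟩
  rw [lengthLaw, integral_map (by fun_prop) (by fun_prop)]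
  have : ∀ p : ℝ × ℝ, √(p.1 ^ 2 + p.2 ^ 2) ^ 2 = p.1 ^ 2 + p.2 ^ 2 := fun p =>
    Real.sq_sqrt (by positivity)
  simp only [this]
  rw [integral_add (hint.comp_fst _) (hint.comp_snd _), integral_fun_fst (fun u => u ^ 2),
    integral_fun_snd (fun u => u ^ 2), hsq]
  norm_num

/-! ### The numerical values of the mean lengths -/

/-- The layer-cake formula; capping at 1 means that the distribution function is needed only on `[0,
1]`, where it is a polynomial for transfer lengths. -/
lemma integral_min_one {α : Type*} [MeasurableSpace α] {μ : Measure α} [IsProbabilityMeasure μ]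
    {f : α → ℝ} (hf : Measurable f) (h0 : 0 ≤ᵐ[μ] f) :
    ∫ x, min (f x) 1 ∂μ = ∫ t in (0 : ℝ)..1, (1 - μ.real {x | f x ≤ t}) := by
  have hmem : ∀ᵐ x ∂μ, min (f x) 1 ∈ Icc (0 : ℝ) 1 := by
    filter_upwards [h0] with x hx
    exact ⟨le_min hx zero_le_one, min_le_right _ _⟩
  have hint : Integrable (fun x => min (f x) 1) μ :=
    Integrable.of_mem_Icc 0 1 (hf.min measurable_const).aemeasurable hmem
  rw [hint.integral_eq_integral_meas_lt (hmem.mono fun x hx => hx.1),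
    intervalIntegral.integral_of_le zero_le_one, ← integral_indicator measurableSet_Ioi,
    ← integral_indicator measurableSet_Ioc]
  refine integral_congr_ae ?_
  -- At `t = 1` the integrands may differ: the capped function never exceeds 1, but `f` may do so
  -- with positive probability.
  filter_upwards [Measure.ae_ne volume (1 : ℝ)] with t ht
  by_cases h : 0 < t
  · rw [indicator_of_mem (show t ∈ Ioi 0 from h)]
    rcases lt_or_gt_of_ne ht with h1 | h1
    · rw [indicator_of_mem (show t ∈ Ioc 0 1 from ⟨h, h1.le⟩),
        ← probReal_compl_eq_one_sub (measurableSet_le hf measurable_const)]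
      congr 1
      ext x
      simp [h1]
    · rw [indicator_of_notMem (fun h' => absurd h'.2 (not_le.2 h1))]
      have : {a | t < min (f a) 1} = ∅ := by
        ext x
        simp only [mem_ofPred_eq, mem_empty_iff_false, iff_false, not_lt]
        exact (min_le_right _ _).trans h1.le
      simp only [this, measureReal_empty]
  · rw [indicator_of_notMem (show t ∉ Ioi 0 from h), indicator_of_notMem (fun h' => h h'.1)]

/-- The expectation of the part of the length of a transfer which exceeds `1`. -/
noncomputable def meanExcess : ℝ := ∫ t, max (t - 1) 0 ∂lengthLaw

lemma integrable_lengthLaw {f : ℝ → ℝ} (hf : Continuous f) : Integrable f lengthLaw := by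
  obtain ⟨a, ha⟩ := (isCompact_Icc (a := 0) (b := √2)).bddBelow_image hf.continuousOn
  obtain ⟨b, hb⟩ := (isCompact_Icc (a := 0) (b := √2)).bddAbove_image hf.continuousOn
  refine Integrable.of_mem_Icc a b hf.aemeasurable ?_
  filter_upwards [ae_lengthLaw_mem_Icc] with t ht
  exact ⟨ha (mem_image_of_mem f ht), hb (mem_image_of_mem f ht)⟩

lemma integral_poly_eq {f F : ℝ → ℝ} (hF : ∀ t ∈ Icc (0 : ℝ) 1, HasDerivAt F (f t) t)
    (hf : ContinuousOn f (Icc 0 1)) : ∫ t in (0 : ℝ)..1, f t = F 1 - F 0 := by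
  rw [← uIcc_of_le zero_le_one] at hF hf
  exact intervalIntegral.integral_eq_sub_of_hasDerivAt hF hf.intervalIntegrable

lemma integral_min_lengthLaw :
    ∫ t, min t 1 ∂lengthLaw = 47 / 30 - Real.pi / 3 := by
  rw [integral_min_one (f := fun t => t) measurable_id (ae_lengthLaw_mem_Icc.mono fun t ht => ht.1)]
  have : ∫ t in (0 : ℝ)..1, (1 - lengthLaw.real {x | x ≤ t})
      = ∫ t in (0 : ℝ)..1, (1 - (Real.pi * t ^ 2 - 8 / 3 * t ^ 3 + t ^ 4 / 2)) := by
    refine intervalIntegral.integral_congr fun t ht => ?_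
    rw [uIcc_of_le zero_le_one] at ht
    rw [← lengthLaw_real_Iic ht.1 ht.2]; rfl
  rw [this, integral_poly_eq (F := fun t => t - (Real.pi / 3 * t ^ 3 - 2 / 3 * t ^ 4 + t ^ 5 / 10))
    (fun t _ => ?_) (Continuous.continuousOn (by fun_prop))]
  · norm_num; ring
  · refine ((hasDerivAt_id t).sub ((((hasDerivAt_pow 3 t).const_mul (Real.pi / 3)).sub
      ((hasDerivAt_pow 4 t).const_mul (2 / 3))).add
      ((hasDerivAt_pow 5 t).div_const 10))).congr_deriv ?_
    norm_num
    ring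

/-- The second moment is known exactly, so subtracting its capped part gives the tail above 1
without the distribution function there. -/
lemma integral_excess_sq_lengthLaw :
    ∫ t, max (t ^ 2 - 1) 0 ∂lengthLaw = Real.pi / 2 - 47 / 30 := by
  have hmin : ∫ t, min (t ^ 2) 1 ∂lengthLaw = 19 / 10 - Real.pi / 2 := by
    rw [integral_min_one (by fun_prop) (ae_of_all _ fun t => sq_nonneg t)]
    have : ∫ s in (0 : ℝ)..1, (1 - lengthLaw.real {x | x ^ 2 ≤ s})
        = ∫ s in (0 : ℝ)..1, (1 - (Real.pi * s - 8 / 3 * (s * √s) + s ^ 2 / 2)) := by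
      refine intervalIntegral.integral_congr fun s hs => ?_
      rw [uIcc_of_le zero_le_one] at hs
      have hF := lengthLaw_real_Iic (Real.sqrt_nonneg s) (Real.sqrt_le_one.2 hs.2)
      have hset : lengthLaw.real {x | x ^ 2 ≤ s} = lengthLaw.real (Iic √s) := by
        refine measureReal_congr ?_
        filter_upwards [ae_lengthLaw_mem_Icc] with x hx
        exact propext (Real.le_sqrt hx.1 hs.1).symm
      have hsq := Real.sq_sqrt hs.1
      rw [hset, hF, show √s ^ 3 = √s ^ 2 * √s by ring, show √s ^ 4 = (√s ^ 2) ^ 2 by ring, hsq]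
    rw [this, intervalIntegral.integral_eq_sub_of_hasDerivAt_of_le zero_le_one
      (f := fun s => s - (Real.pi / 2 * s ^ 2 - 16 / 15 * (s ^ 2 * √s) + s ^ 3 / 6))
      (Continuous.continuousOn (by fun_prop)) (fun s hs => ?_)
      (Continuous.intervalIntegrable (by fun_prop) _ _)]
    · norm_num; ring
    · refine ((hasDerivAt_id s).sub ((((hasDerivAt_pow 2 s).const_mul (Real.pi / 2)).sub
        (((hasDerivAt_pow 2 s).mul (Real.hasDerivAt_sqrt hs.1.ne')).const_mul (16 / 15))).add
        ((hasDerivAt_pow 3 s).div_const 6))).congr_deriv ?_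
      have hsq := Real.sq_sqrt hs.1.le
      have hs0 : √s ≠ 0 := (Real.sqrt_pos.2 hs.1).ne'
      have hinv : s ^ 2 * (1 / (2 * √s)) = s * √s / 2 := by
        field_simp
        rw [hsq, sq]
      rw [hinv]
      norm_num
      ring
  have hsplit : ∀ t : ℝ, max (t ^ 2 - 1) 0 = t ^ 2 - min (t ^ 2) 1 := fun t => by
    rcases le_total (t ^ 2) 1 with h | h
    · rw [max_eq_right (by linarith), min_eq_left h, sub_self]
    · rw [max_eq_left (by linarith), min_eq_right h]
  simp only [hsplit]
  rw [integral_sub (integrable_lengthLaw (by fun_prop)) (integrable_lengthLaw (by fun_prop)), hmin,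
    integral_sq_lengthLaw]
  ring

/-- Since `t - 1 = (t² - 1) / (t + 1)`, and `2 ≤ t + 1 ≤ 5/2` for `1 ≤ t ≤ √2`, the excess of the
length is between `2/5` and `1/2` of the excess of its square. -/
lemma meanExcess_bounds :
    2 / 5 * (Real.pi / 2 - 47 / 30) ≤ meanExcess ∧
      meanExcess ≤ 1 / 2 * (Real.pi / 2 - 47 / 30) := by
  rw [← integral_excess_sq_lengthLaw, ← integral_const_mul, ← integral_const_mul, meanExcess]
  have h2 : √2 ≤ 3 / 2 := by rw [Real.sqrt_le_left (by norm_num)]; norm_num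
  constructor
  all_goals
    refine integral_mono_ae (integrable_lengthLaw (by fun_prop)) (integrable_lengthLaw (by fun_prop))
      ?_
    filter_upwards [ae_lengthLaw_mem_Icc] with t ht
    rcases le_total t 1 with h | h
    · have hle : t ^ 2 ≤ 1 := pow_le_one₀ ht.1 h
      rw [max_eq_right (a := t ^ 2 - 1) (by linarith), max_eq_right (by linarith), mul_zero]
    · have hle : 1 ≤ t ^ 2 := one_le_pow₀ h
      rw [max_eq_left (b := (0 : ℝ)) (a := t ^ 2 - 1) (by linarith), max_eq_left (by linarith)]
      nlinarith [ht.2]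

lemma meanLength_eq_integral : meanLength = ∫ t, t ∂lengthLaw := by
  rw [← map_dist_eq_lengthLaw, integral_map (by fun_prop) (by fun_prop), meanLength]

lemma meanMaxLength_eq_integral :
    meanMaxLength = ∫ p : ℝ × ℝ, max p.1 p.2 ∂lengthLaw.prod lengthLaw := by
  rw [← map_dist_eq_lengthLaw, Measure.map_prod_map _ _ (by fun_prop) (by fun_prop),
    integral_map (by fun_prop) (by fun_prop), meanMaxLength]
  rfl

lemma eq_min_add_max (x : ℝ) : x = min x 1 + max (x - 1) 0 := by
  rcases le_total x 1 with h | h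
  · rw [min_eq_left h, max_eq_right (by linarith), add_zero]
  · rw [min_eq_right h, max_eq_left (by linarith)]; ring

lemma meanLength_eq : meanLength = 47 / 30 - Real.pi / 3 + meanExcess := by
  rw [meanLength_eq_integral, ← integral_min_lengthLaw, meanExcess,
    ← integral_add (integrable_lengthLaw (by fun_prop)) (integrable_lengthLaw (by fun_prop))]
  exact integral_congr_ae (ae_of_all _ eq_min_add_max)

lemma integral_min_max_lengthLaw :
    ∫ p : ℝ × ℝ, min (max p.1 p.2) 1 ∂lengthLaw.prod lengthLaw
      = 1 - (Real.pi ^ 2 / 5 - 47 / 63 * Real.pi + 64 / 63 - 11 / 36) := by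
  have h0 : 0 ≤ᵐ[lengthLaw.prod lengthLaw] fun p : ℝ × ℝ => max p.1 p.2 := by
    filter_upwards [Measure.quasiMeasurePreserving_fst.ae ae_lengthLaw_mem_Icc] with p hp
    exact hp.1.trans (le_max_left _ _)
  rw [integral_min_one (by fun_prop) h0]
  have : ∫ t in (0 : ℝ)..1, (1 - (lengthLaw.prod lengthLaw).real {p : ℝ × ℝ | max p.1 p.2 ≤ t})
      = ∫ t in (0 : ℝ)..1, (1 - (Real.pi * t ^ 2 - 8 / 3 * t ^ 3 + t ^ 4 / 2) ^ 2) := by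
    refine intervalIntegral.integral_congr fun t ht => ?_
    rw [uIcc_of_le zero_le_one] at ht
    have hset : {p : ℝ × ℝ | max p.1 p.2 ≤ t} = Iic t ×ˢ Iic t := by
      ext p; simp only [mem_ofPred_eq, max_le_iff, mem_prod, mem_Iic]
    rw [hset, measureReal_prod_prod, lengthLaw_real_Iic ht.1 ht.2, ← sq]
  rw [this, integral_poly_eq (F := fun t => t - (Real.pi ^ 2 / 5 * t ^ 5 - 8 / 9 * Real.pi * t ^ 6
    + (64 / 9 + Real.pi) / 7 * t ^ 7 - 1 / 3 * t ^ 8 + t ^ 9 / 36))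
    (fun t _ => ?_) (Continuous.continuousOn (by fun_prop))]
  · norm_num; ring
  · refine ((hasDerivAt_id t).sub ((((((hasDerivAt_pow 5 t).const_mul (Real.pi ^ 2 / 5)).sub
      ((hasDerivAt_pow 6 t).const_mul (8 / 9 * Real.pi))).add
      ((hasDerivAt_pow 7 t).const_mul ((64 / 9 + Real.pi) / 7))).sub
      ((hasDerivAt_pow 8 t).const_mul (1 / 3))).add
      ((hasDerivAt_pow 9 t).div_const 36))).congr_deriv ?_
    norm_num
    ring

/-- The excess of the maximum is at most the sum of the two excesses. It is at least that sum after
discarding the first excess whenever the second length is above 1; by independence this keeps the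
factor `1 + P(l ≤ 1)`, where `P(l ≤ 1) = π - 13/6`. -/
lemma integral_excess_max_bounds :
    (Real.pi - 13 / 6 + 1) * meanExcess
        ≤ ∫ p : ℝ × ℝ, max (max p.1 p.2 - 1) 0 ∂lengthLaw.prod lengthLaw ∧
      ∫ p : ℝ × ℝ, max (max p.1 p.2 - 1) 0 ∂lengthLaw.prod lengthLaw ≤ 2 * meanExcess := by
  have hex : Integrable (fun t : ℝ => max (t - 1) 0) lengthLaw :=
    integrable_lengthLaw (by fun_prop)
  have hfst := hex.comp_fst lengthLaw
  have hsnd := hex.comp_snd lengthLaw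
  have hind : Integrable ((Ioi (1 : ℝ)).indicator (1 : ℝ → ℝ)) lengthLaw :=
    (integrable_const (1 : ℝ)).indicator measurableSet_Ioi
  have hprod : Integrable (fun p : ℝ × ℝ => max (p.1 - 1) 0 * (Ioi (1 : ℝ)).indicator 1 p.2)
      (lengthLaw.prod lengthLaw) := hex.mul_prod hind
  have hmax : Integrable (fun p : ℝ × ℝ => max (max p.1 p.2 - 1) 0)
      (lengthLaw.prod lengthLaw) := by
    refine (hfst.add hsnd).mono (by fun_prop) (ae_of_all _ fun p => ?_)
    have h1 : 0 ≤ max (p.1 - 1) 0 := le_max_right _ _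
    have h2 : 0 ≤ max (p.2 - 1) 0 := le_max_right _ _
    simp only [Pi.add_apply]
    rw [Real.norm_of_nonneg (le_max_right _ _), Real.norm_of_nonneg (add_nonneg h1 h2)]
    rcases max_cases p.1 p.2 with h | h <;> rw [h.1] <;> linarith
  have e1 : ∫ p : ℝ × ℝ, max (p.1 - 1) 0 ∂lengthLaw.prod lengthLaw = meanExcess := by
    rw [integral_fun_fst (fun t : ℝ => max (t - 1) 0)]; simp [meanExcess]
  have e2 : ∫ p : ℝ × ℝ, max (p.2 - 1) 0 ∂lengthLaw.prod lengthLaw = meanExcess := by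
    rw [integral_fun_snd (fun t : ℝ => max (t - 1) 0)]; simp [meanExcess]
  have e3 : ∫ p : ℝ × ℝ, max (p.1 - 1) 0 * (Ioi (1 : ℝ)).indicator 1 p.2
      ∂lengthLaw.prod lengthLaw = meanExcess * (1 - (Real.pi - 13 / 6)) := by
    rw [integral_prod_mul (fun t : ℝ => max (t - 1) 0) ((Ioi (1 : ℝ)).indicator 1),
      integral_indicator_one measurableSet_Ioi, ← compl_Iic,
      probReal_compl_eq_one_sub measurableSet_Iic, lengthLaw_real_Iic zero_le_one le_rfl, meanExcess]
    ring
  constructor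
  · calc (Real.pi - 13 / 6 + 1) * meanExcess
        = ∫ p : ℝ × ℝ, (max (p.1 - 1) 0 + max (p.2 - 1) 0
          - max (p.1 - 1) 0 * (Ioi (1 : ℝ)).indicator 1 p.2) ∂lengthLaw.prod lengthLaw := by
          rw [integral_sub (f := fun p : ℝ × ℝ => max (p.1 - 1) 0 + max (p.2 - 1) 0) (hfst.add hsnd)
            hprod, integral_add hfst hsnd, e1, e2, e3]; ring
      _ ≤ _ := by
          refine integral_mono ((hfst.add hsnd).sub hprod) hmax fun p => ?_
          simp only
          by_cases h : p.2 ∈ Ioi (1 : ℝ)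
          · rw [indicator_of_mem h, Pi.one_apply, mul_one, add_sub_cancel_left]
            exact max_le_max (sub_le_sub_right (le_max_right _ _) _) le_rfl
          · rw [indicator_of_notMem h, mul_zero, sub_zero,
              max_eq_right (a := p.2 - 1) (by simpa using h), add_zero]
            exact max_le_max (sub_le_sub_right (le_max_left _ _) _) le_rfl
  · calc _ ≤ ∫ p : ℝ × ℝ, (max (p.1 - 1) 0 + max (p.2 - 1) 0) ∂lengthLaw.prod lengthLaw := by
          refine integral_mono hmax (hfst.add hsnd) fun p => ?_
          have h1 : 0 ≤ max (p.1 - 1) 0 := le_max_right _ _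
          have h2 : 0 ≤ max (p.2 - 1) 0 := le_max_right _ _
          simp only
          rcases max_cases p.1 p.2 with h | h <;> rw [h.1] <;> linarith
      _ = _ := by rw [integral_add hfst hsnd, e1, e2]; ring

lemma integral_max_split :
    meanMaxLength = ∫ p : ℝ × ℝ, min (max p.1 p.2) 1 ∂lengthLaw.prod lengthLaw
      + ∫ p : ℝ × ℝ, max (max p.1 p.2 - 1) 0 ∂lengthLaw.prod lengthLaw := by
  have hmem : ∀ᵐ p ∂lengthLaw.prod lengthLaw, max p.1 p.2 ∈ Icc 0 √2 := by
    filter_upwards [Measure.quasiMeasurePreserving_fst.ae ae_lengthLaw_mem_Icc,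
      Measure.quasiMeasurePreserving_snd.ae ae_lengthLaw_mem_Icc] with p hp hp'
    exact ⟨hp.1.trans (le_max_left _ _), max_le hp.2 hp'.2⟩
  rw [meanMaxLength_eq_integral, ← integral_add]
  · exact integral_congr_ae (ae_of_all _ fun p => eq_min_add_max _)
  · refine Integrable.of_mem_Icc 0 1 (by fun_prop) ?_
    filter_upwards [hmem] with p hp
    exact ⟨le_min hp.1 zero_le_one, min_le_right _ _⟩
  · refine Integrable.of_mem_Icc 0 √2 (by fun_prop) ?_
    filter_upwards [hmem] with p hp
    exact ⟨le_max_right _ _, max_le (by linarith [hp.2]) (Real.sqrt_nonneg 2)⟩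

theorem mean_numerical_bounds :
    |meanLength - 0.52| < 0.005 ∧ |meanMaxLength - 0.66| < 0.005 ∧
      |meanMaxLength / (2 * meanLength) - 0.64| < 0.005 := by
  have hδ := meanExcess_bounds
  have hm := integral_excess_max_bounds
  have hM := integral_max_split
  rw [integral_min_max_lengthLaw] at hM
  have hL := meanLength_eq
  have p1 := Real.pi_gt_d6
  have p2 := Real.pi_lt_d6
  have q1 : 3.141592 * 3.141592 < Real.pi ^ 2 := by nlinarith
  have q2 : Real.pi ^ 2 < 3.141593 * 3.141593 := by nlinarith
  -- Replacing the factor by a rational number makes the remaining inequalities linear in `π`, `π²`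
  -- and `meanExcess`.
  have hlow : 1.97 * meanExcess ≤ (Real.pi - 13 / 6 + 1) * meanExcess :=
    mul_le_mul_of_nonneg_right (by linarith) (by linarith)
  have hpos : 0 < 2 * meanLength := by linarith
  refine ⟨?_, ?_, ?_⟩
  · rw [abs_lt]; constructor <;> linarith
  · rw [abs_lt]; constructor <;> linarith
  · rw [abs_lt, lt_sub_iff_add_lt, sub_lt_iff_lt_add, lt_div_iff₀ hpos, div_lt_iff₀ hpos]
    constructor <;> linarith

/-! ### Cheap orderings of the random pairs -/

/-- The cell which contains a point of the unit square, for a grid of mesh `1 / K`. -/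
noncomputable def gridCell (K : ℕ) (x : Plane) : Fin 2 → Fin (K + 1) :=
  fun i => Fin.ofNat (K + 1) ⌊K * x i⌋₊

lemma measurable_gridCell (K : ℕ) : Measurable (gridCell K) := by
  refine measurable_pi_lambda _ fun i => ?_
  exact (measurable_from_top (f := fun n => Fin.ofNat (K + 1) n)).comp
    (Nat.measurable_floor.comp (by fun_prop))

lemma dist_le_of_coord {x y : Plane} {a : ℝ} (h : ∀ i, |x i - y i| ≤ a) : dist x y ≤ 2 * a := by
  have ha : 0 ≤ a := (abs_nonneg _).trans (h 0)
  rw [EuclideanSpace.dist_eq, Fin.sum_univ_two, Real.sqrt_le_left (by positivity)]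
  have h0 := h 0
  have h1 := h 1
  rw [← Real.dist_eq] at h0 h1
  nlinarith [mul_self_le_mul_self dist_nonneg h0, mul_self_le_mul_self dist_nonneg h1]

lemma dist_le_two_of_mem_unitSquare {x y : Plane} (hx : x ∈ unitSquare) (hy : y ∈ unitSquare) :
    dist x y ≤ 2 := by
  have := dist_le_of_coord (x := x) (y := y) (a := 1) fun i => by
    rw [abs_le]; constructor <;> linarith [(hx i).1, (hx i).2, (hy i).1, (hy i).2]
  linarith

lemma dist_le_of_gridCell_eq {K : ℕ} (hK : 0 < K) {x y : Plane} (hx : x ∈ unitSquare)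
    (hy : y ∈ unitSquare) (h : gridCell K x = gridCell K y) : dist x y ≤ 2 * (1 / K) := by
  have hK' : (0 : ℝ) < K := by exact_mod_cast hK
  -- The reduction modulo `K + 1` in the cell index is harmless on the square; the extra index `K`
  -- is for coordinates equal to 1.
  have hfloor : ∀ {z : Plane}, z ∈ unitSquare → ∀ i, ⌊K * z i⌋₊ < K + 1 := fun hz i => by
    rw [Nat.lt_succ_iff]
    exact Nat.floor_le_of_le (mul_le_of_le_one_right hK'.le (hz i).2)
  refine dist_le_of_coord fun i => ?_
  have hi := congrArg Fin.val (congrFun h i)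
  simp only [gridCell, Fin.val_ofNat, Nat.mod_eq_of_lt (hfloor hx i),
    Nat.mod_eq_of_lt (hfloor hy i)] at hi
  have hx1 := Nat.floor_le (mul_nonneg hK'.le (hx i).1)
  have hy1 := Nat.floor_le (mul_nonneg hK'.le (hy i).1)
  have hx2 := Nat.lt_floor_add_one (K * x i)
  have hy2 := Nat.lt_floor_add_one (K * y i)
  rw [hi] at hx1 hx2
  rw [le_div_iff₀ hK', ← abs_of_pos hK', ← abs_mul, abs_le]
  constructor <;> nlinarith

/-- The cells of two points. -/
abbrev PairCell (K : ℕ) : Type := (Fin 2 → Fin (K + 1)) × (Fin 2 → Fin (K + 1))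

/-- The cells of the starts of a pair. -/
noncomputable def startCell (K : ℕ) (q : (Plane × Plane) × (Plane × Plane)) : PairCell K :=
  (gridCell K q.1.1, gridCell K q.2.1)

/-- The cells of the goals of a pair. -/
noncomputable def goalCell (K : ℕ) (q : (Plane × Plane) × (Plane × Plane)) : PairCell K :=
  (gridCell K q.1.2, gridCell K q.2.2)

/-- The starts of a pair are in the cells `x` and its goals are in the cells `y`. -/
def cellEvent (K : ℕ) (x y : PairCell K) : Set ((Plane × Plane) × (Plane × Plane)) :=
  {q | startCell K q = x ∧ goalCell K q = y}

/-- The number of the pairs with starts in the cells `x` and goals in the cells `y`. -/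
noncomputable def cellCount (K : ℕ) {m : ℕ} (e : Assignment m) (s g : Fin (2 * m) → Plane)
    (x y : PairCell K) : ℝ :=
  ∑ i, (cellEvent K x y).indicator 1 (pairPoints e s g i)

lemma cellCount_eq (K : ℕ) {m : ℕ} (e : Assignment m) (s g : Fin (2 * m) → Plane)
    (x y : PairCell K) :
    cellCount K e s g x y = (Finset.univ.filter fun i =>
      startCell K (pairPoints e s g i) = x ∧ goalCell K (pairPoints e s g i) = y).card := by
  rw [Finset.card_filter, cellCount]
  push_cast
  refine Finset.sum_congr rfl fun i _ => ?_
  simp only [indicator_apply, cellEvent, mem_ofPred_eq, Pi.one_apply]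

lemma measurableSet_cellEvent (K : ℕ) (x y : PairCell K) : MeasurableSet (cellEvent K x y) := by
  have hs : Measurable (startCell K) := ((measurable_gridCell K).comp (by fun_prop)).prodMk
    ((measurable_gridCell K).comp (by fun_prop))
  have hg : Measurable (goalCell K) := ((measurable_gridCell K).comp (by fun_prop)).prodMk
    ((measurable_gridCell K).comp (by fun_prop))
  exact (hs (measurableSet_singleton x)).inter (hg (measurableSet_singleton y))

instance : IsProbabilityMeasure pairLaw := by unfold pairLaw; infer_instance

/-- Start and goal of each object are exchangeable. This symmetry is why opposite classes of pairs
balance. -/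
lemma pairLaw_real_cellEvent_comm (K : ℕ) (x y : PairCell K) :
    pairLaw.real (cellEvent K x y) = pairLaw.real (cellEvent K y x) := by
  have hmap : pairLaw.map (Prod.map Prod.swap Prod.swap) = pairLaw := by
    rw [pairLaw, ← Measure.map_prod_map _ _ measurable_swap measurable_swap, Measure.prod_swap]
  conv_lhs => rw [← hmap]
  rw [map_measureReal_apply (measurable_swap.prodMap measurable_swap) (measurableSet_cellEvent K x y)]
  congr 1
  ext q
  exact and_comm

section model

variable {Ω : Type*} [MeasurableSpace Ω] {P : Measure Ω} [IsProbabilityMeasure P]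
  {start goal : ℕ → Ω → Plane} {split : ∀ m, Ω → Assignment m}

lemma ae_mem_unitSquare : ∀ᵐ x ∂uniformSquare, x ∈ unitSquare := by
  refine ae_cond_mem ?_
  have : unitSquare = ⋂ i : Fin 2, (fun x : Plane => x i) ⁻¹' Icc (0 : ℝ) 1 := by
    ext x; simp [unitSquare]
  rw [this]
  exact MeasurableSet.iInter fun i => measurableSet_preimage (by fun_prop) measurableSet_Icc

namespace IsRandomModel

omit [IsProbabilityMeasure P] in
lemma ae_mem_unitSquare (h : IsRandomModel P start goal split) :
    ∀ᵐ ω ∂P, ∀ j, start j ω ∈ unitSquare ∧ goal j ω ∈ unitSquare := by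
  rw [ae_all_iff]
  intro j
  have hs := DualArm.ae_mem_unitSquare
  have hg := DualArm.ae_mem_unitSquare
  rw [← h.map_start j] at hs
  rw [← h.map_goal j] at hg
  exact (ae_of_ae_map (h.measurable_start j).aemeasurable hs).and
    (ae_of_ae_map (h.measurable_goal j).aemeasurable hg)

/-- The random pairs can be ordered with a total cost of the moves that is sublinear. -/
theorem eventually_hasOrdering (h : IsRandomModel P start goal split) :
    ∀ᵐ ω ∂P, ∀ ε : ℝ, 0 < ε → ∀ᶠ m : ℕ in atTop,
      HasOrdering (pairMoveCost (split m ω) (firstPoints start (2 * m) ω)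
        (firstPoints goal (2 * m) ω)) Finset.univ (ε * m) := by
  have hcount : ∀ᵐ ω ∂P, ∀ (K : ℕ) (x y : PairCell K), Tendsto (fun m : ℕ =>
      cellCount K (split m ω) (firstPoints start (2 * m) ω) (firstPoints goal (2 * m) ω) x y / m)
      atTop (nhds (pairLaw.real (cellEvent K x y))) := by
    simp only [ae_all_iff]
    intro K x y
    rw [← integral_indicator_one (measurableSet_cellEvent K x y)]
    refine h.tendsto_pair_average (B := 1)
      (measurable_one.indicator (measurableSet_cellEvent K x y)) (ae_of_all _ fun q => ?_)
    by_cases hq : q ∈ cellEvent K x y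
    · rw [indicator_of_mem hq]; simp
    · rw [indicator_of_notMem hq]; simp
  filter_upwards [hcount, h.ae_mem_unitSquare] with ω hω hsq ε hε
  -- The budget `ε m` is split in three: `ε/2` for the short moves inside cells through `K`, `ε/4`
  -- for the imbalance through `ε'`, and `ε/4` for the constant cost `4 C` of the groups through `m
  -- ≥ 16 C / ε`.
  obtain ⟨K, hK⟩ := exists_nat_gt (4 / ε)
  have hK0 : (0 : ℝ) < K := (by positivity : 0 < 4 / ε).trans hK
  have hKε : 2 * (1 / (K : ℝ)) < ε / 2 := by
    rw [div_lt_iff₀ hε] at hK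
    rw [mul_one_div, div_lt_div_iff₀ hK0 two_pos]; linarith
  set C : ℝ := (Fintype.card (Sym2 (PairCell K)) : ℝ) with hC
  have hC0 : 0 ≤ C := Nat.cast_nonneg _
  set ε' : ℝ := ε / (8 * (C + 1)) with hε'
  have hε'0 : 0 < ε' := by positivity
  have hbal : ∀ᶠ m : ℕ in atTop, ∀ x y : PairCell K,
      cellCount K (split m ω) (firstPoints start (2 * m) ω) (firstPoints goal (2 * m) ω) x y / m -
      cellCount K (split m ω) (firstPoints start (2 * m) ω) (firstPoints goal (2 * m) ω) y x / m
        < ε' := by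
    rw [eventually_all]; intro x
    rw [eventually_all]; intro y
    have := (hω K x y).sub (hω K y x)
    rw [pairLaw_real_cellEvent_comm, sub_self] at this
    exact this.eventually_lt_const hε'0
  filter_upwards [hbal, eventually_ge_atTop (⌈16 * C / ε⌉₊ + 1)] with m hm hmC
  have hm0 : (0 : ℝ) < m := by exact_mod_cast (Nat.succ_pos _).trans_le hmC
  have hmC' : 16 * C / ε ≤ m := (Nat.le_ceil _).trans (by exact_mod_cast (Nat.le_succ _).trans hmC)
  have hs : ∀ i, firstPoints start (2 * m) ω i ∈ unitSquare := fun i => (hsq i).1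
  have hg : ∀ i, firstPoints goal (2 * m) ω i ∈ unitSquare := fun i => (hsq i).2
  have hord := hasOrdering_of_balanced (η := 2 * (1 / (K : ℝ))) (D := 2) (M := ε' * m)
    (src := fun i => startCell K (pairPoints (split m ω) (firstPoints start (2 * m) ω)
        (firstPoints goal (2 * m) ω) i))
    (tgt := fun i => goalCell K (pairPoints (split m ω) (firstPoints start (2 * m) ω)
        (firstPoints goal (2 * m) ω) i))
    (c := pairMoveCost (split m ω) (firstPoints start (2 * m) ω)
        (firstPoints goal (2 * m) ω)) (by positivity)
    (fun i j hij => max_le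
      (dist_le_of_gridCell_eq (by exact_mod_cast hK0) (hg _) (hs _) (congrArg Prod.fst hij))
      (dist_le_of_gridCell_eq (by exact_mod_cast hK0) (hg _) (hs _) (congrArg Prod.snd hij)))
    (fun i j => max_le (dist_le_two_of_mem_unitSquare (hg _) (hs _))
      (dist_le_two_of_mem_unitSquare (hg _) (hs _))) zero_le_two (by positivity)
    (fun x y => by
      have := hm x y
      rw [← sub_div, div_lt_iff₀ hm0, cellCount_eq, cellCount_eq] at this
      exact this.le)
  refine hord.mono ?_
  rw [Fintype.card_fin, ← hC]
  have h1 : 2 * (1 / (K : ℝ)) * m ≤ ε / 2 * m := by gcongr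
  have h2 : C * (2 * (ε' * m)) ≤ ε / 4 * m := by
    rw [hε', show C * (2 * (ε / (8 * (C + 1)) * m)) = C / (C + 1) * (ε / 4 * m) by field_simp; ring]
    exact mul_le_of_le_one_left (by positivity) ((div_le_one (by positivity)).2 (by linarith))
  have h3 : C * 4 ≤ ε / 4 * m := by
    rw [div_le_iff₀ hε] at hmC'; linarith
  nlinarith

end IsRandomModel

end model

/-! ### Synchronized solutions with given pairs -/

/-- The sum over all pairs of the larger of the two transfer distances. -/
noncomputable def pairTransferCost {m : ℕ} (e : Assignment m) (s g : Fin (2 * m) → Plane) : ℝ :=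
  ∑ i, max (dist (s (e.obj i 0)) (g (e.obj i 0))) (dist (s (e.obj i 1)) (g (e.obj i 1)))

/-- There is a synchronized solution with given pairs whose cost is, up to `4 r` per pair, at most
the cost of the best ordering of the pairs without regard to collisions. -/
theorem exists_syncSolution (r : ℝ≥0) {m : ℕ} (e : Assignment m) (s g : Fin (2 * m) → Plane) :
    ∃ D : SyncSolution r s g, D.HasPairs e ∧ ∀ cpd ct : ℝ, 0 ≤ ct →
      m * cpd + ct * pairTransferCost e s g ≤ D.cost cpd ct ∧
      ∀ B, HasOrdering (pairMoveCost e s g) Finset.univ B →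
        D.cost cpd ct ≤ m * cpd + ct * (pairTransferCost e s g + B + 4 * r * m) := by
  -- An optimal order depends on neither `cpd`, `ct` nor `B`, so one solution satisfies the upper
  -- bound for every available `B`.
  obtain ⟨σ, hσ⟩ := Finite.exists_min fun σ : Equiv.Perm (Fin m) =>
    orderCost (pairMoveCost e s g) σ
  choose γ hγ hγ' using exists_isCoordinatedMotion r
  let D : SyncSolution r s g :=
    { assignment := (σ.prodCongr (Equiv.refl _)).trans e
      transfer := fun i => γ (fun k => s (e.obj (σ i) k)) (fun k => g (e.obj (σ i) k))
      move := fun i => if h : (i : ℕ) + 1 < m then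
        γ (fun k => g (e.obj (σ i) k)) (fun k => s (e.obj (σ ⟨(i : ℕ) + 1, h⟩) k)) else fun _ _ => 0
      transfer_spec := fun i => hγ _ _
      move_spec := fun i h => by rw [dif_pos h]; exact hγ _ _ }
  have htransfer : ∑ i, max (dist (s (e.obj (σ i) 0)) (g (e.obj (σ i) 0)))
      (dist (s (e.obj (σ i) 1)) (g (e.obj (σ i) 1))) = pairTransferCost e s g :=
    Equiv.sum_comp σ fun i =>
      max (dist (s (e.obj i 0)) (g (e.obj i 0))) (dist (s (e.obj i 1)) (g (e.obj i 1)))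
  have harc : ∀ γ : Fin 2 → ℝ → Plane, 0 ≤ motionLength γ := fun γ =>
    le_max_of_le_left ENNReal.toReal_nonneg
  refine ⟨D, ⟨σ, fun i k => rfl⟩, fun cpd ct hct => ⟨?_, fun B hB => ?_⟩⟩
  · have h1 : pairTransferCost e s g ≤ ∑ i, motionLength (D.transfer i) := by
      rw [← htransfer]
      exact Finset.sum_le_sum fun i _ => (D.transfer_spec i).le_motionLength
    have h2 : 0 ≤ ∑ i : Fin m, if (i : ℕ) + 1 < m then motionLength (D.move i) else 0 :=
      Finset.sum_nonneg fun i _ => by split_ifs <;> simp [harc]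
    unfold SyncSolution.cost
    linarith [mul_le_mul_of_nonneg_left h1 hct, mul_nonneg hct h2]
  · have h1 : ∑ i, motionLength (D.transfer i) ≤ pairTransferCost e s g + 2 * r * m := by
      calc ∑ i, motionLength (D.transfer i)
          ≤ ∑ i, (max (dist (s (e.obj (σ i) 0)) (g (e.obj (σ i) 0)))
            (dist (s (e.obj (σ i) 1)) (g (e.obj (σ i) 1))) + 2 * (r : ℝ)) :=
            Finset.sum_le_sum fun i _ => hγ' _ _
        _ = _ := by
            rw [Finset.sum_add_distrib, htransfer]
            simp; ring
    have h2 : ∑ i : Fin m, (if (i : ℕ) + 1 < m then motionLength (D.move i) else 0)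
        ≤ B + 2 * r * m := by
      obtain ⟨τ, hτ⟩ := hB.exists_perm
      calc ∑ i : Fin m, (if (i : ℕ) + 1 < m then motionLength (D.move i) else 0)
          ≤ ∑ i : Fin m, ((if h : (i : ℕ) + 1 < m then
              pairMoveCost e s g (σ i) (σ ⟨(i : ℕ) + 1, h⟩) else 0) + 2 * (r : ℝ)) := by
            refine Finset.sum_le_sum fun i _ => ?_
            by_cases h : (i : ℕ) + 1 < m
            · rw [if_pos h, dif_pos h]
              simp only [D, dif_pos h]
              exact hγ' _ _
            · rw [if_neg h, dif_neg h]; positivity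
        _ = orderCost (pairMoveCost e s g) σ + 2 * r * m := by
            rw [Finset.sum_add_distrib, orderCost]
            simp; ring
        _ ≤ _ := by linarith [hσ τ]
    unfold SyncSolution.cost
    have := mul_le_mul_of_nonneg_left (add_le_add h1 h2) hct
    linarith

/-! ### The asymptotic cost ratio -/

lemma transitLength_nonneg {n : ℕ} (s g : Fin n → Plane) (σ : Equiv.Perm (Fin n)) :
    0 ≤ transitLength s g σ :=
  Finset.sum_nonneg fun i _ => by split_ifs <;> positivity

lemma sum_objects_eq_sum_pairs {m : ℕ} (e : Assignment m) (f : Fin (2 * m) → ℝ) :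
    ∑ j, f j = ∑ i, (f (e.obj i 0) + f (e.obj i 1)) := by
  rw [← Equiv.sum_comp (show (Fin m × Fin 2) ≃ Fin (2 * m) from e) f, Fintype.sum_prod_type]
  refine Finset.sum_congr rfl fun i _ => ?_
  rw [Fin.sum_univ_two]
  rfl

lemma ae_dist_mem_Icc :
    ∀ᵐ p ∂uniformSquare.prod uniformSquare, dist p.1 p.2 ∈ Icc (0 : ℝ) 2 := by
  filter_upwards [Measure.quasiMeasurePreserving_fst.ae ae_mem_unitSquare,
    Measure.quasiMeasurePreserving_snd.ae ae_mem_unitSquare] with p h1 h2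
  exact ⟨dist_nonneg, dist_le_two_of_mem_unitSquare h1 h2⟩

lemma ae_pairLaw_dist_mem_Icc :
    ∀ᵐ q ∂pairLaw, dist q.1.1 q.1.2 ∈ Icc (0 : ℝ) 2 ∧ dist q.2.1 q.2.2 ∈ Icc (0 : ℝ) 2 :=
  (Measure.quasiMeasurePreserving_fst.ae ae_dist_mem_Icc).and
    (Measure.quasiMeasurePreserving_snd.ae ae_dist_mem_Icc)

lemma integral_pairLaw_add :
    ∫ q, (dist q.1.1 q.1.2 + dist q.2.1 q.2.2) ∂pairLaw = 2 * meanLength := by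
  have hint : Integrable (fun p : Plane × Plane => dist p.1 p.2)
      (uniformSquare.prod uniformSquare) :=
    Integrable.of_mem_Icc 0 2 (by fun_prop) ae_dist_mem_Icc
  rw [pairLaw, integral_add (hint.comp_fst _) (hint.comp_snd _),
    integral_fun_fst (fun p : Plane × Plane => dist p.1 p.2),
    integral_fun_snd (fun p : Plane × Plane => dist p.1 p.2)]
  simp [meanLength]
  ring

section model

variable {Ω : Type*} [MeasurableSpace Ω] {P : Measure Ω} [IsProbabilityMeasure P]
  {start goal : ℕ → Ω → Plane} {split : ∀ m, Ω → Assignment m}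

namespace IsRandomModel

/-- Summing over objects is summing over the random pairs, so the law of large numbers for pairs
also serves the single arm. -/
lemma tendsto_sum_dist (h : IsRandomModel P start goal split) :
    ∀ᵐ ω ∂P, Tendsto (fun m : ℕ => (∑ j, dist (firstPoints start (2 * m) ω j)
      (firstPoints goal (2 * m) ω j)) / m) atTop (nhds (2 * meanLength)) := by
  have := h.tendsto_pair_average (B := 4)
    (f := fun q => dist q.1.1 q.1.2 + dist q.2.1 q.2.2) (by fun_prop)
    (ae_pairLaw_dist_mem_Icc.mono fun q hq =>
      ⟨add_nonneg hq.1.1 hq.2.1, by linarith [hq.1.2, hq.2.2]⟩)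
  rw [integral_pairLaw_add] at this
  filter_upwards [this] with ω hω
  refine hω.congr fun m => ?_
  rw [sum_objects_eq_sum_pairs (split m ω)]
  rfl

lemma tendsto_pairTransferCost (h : IsRandomModel P start goal split) :
    ∀ᵐ ω ∂P, Tendsto (fun m : ℕ => pairTransferCost (split m ω) (firstPoints start (2 * m) ω)
      (firstPoints goal (2 * m) ω) / m) atTop (nhds meanMaxLength) :=
  h.tendsto_pair_average (B := 2)
    (f := fun q => max (dist q.1.1 q.1.2) (dist q.2.1 q.2.2)) (by fun_prop)
    (ae_pairLaw_dist_mem_Icc.mono fun q hq =>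
      ⟨hq.1.1.trans (le_max_left _ _), max_le hq.1.2 hq.2.2⟩)

lemma tendsto_transitLength (h : IsRandomModel P start goal split) :
    ∀ᵐ ω ∂P, Tendsto (fun m : ℕ => (⨅ σ, transitLength (firstPoints start (2 * m) ω)
      (firstPoints goal (2 * m) ω) σ) / m) atTop (nhds 0) := by
  filter_upwards [h.eventually_hasOrdering, h.ae_mem_unitSquare] with ω hω hsq
  rw [Metric.tendsto_nhds]
  intro ε hε
  filter_upwards [hω (ε / 4) (by positivity), eventually_gt_atTop ⌈4 / ε⌉₊] with m hm hmε
  have hmε' : 4 / ε < m := (Nat.le_ceil _).trans_lt (by exact_mod_cast hmε)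
  have hm0 : (0 : ℝ) < m := (by positivity : 0 < 4 / ε).trans hmε'
  have hle := iInf_transitLength_le (D := 2) (split m ω) (firstPoints start (2 * m) ω)
    (firstPoints goal (2 * m) ω)
    (fun i j => dist_le_two_of_mem_unitSquare (hsq i).2 (hsq j).1) zero_le_two hm
  have h0 := Real.iInf_nonneg fun σ => transitLength_nonneg (firstPoints start (2 * m) ω)
    (firstPoints goal (2 * m) ω) σ
  rw [Real.dist_eq, sub_zero, abs_of_nonneg (div_nonneg h0 hm0.le), div_lt_iff₀ hm0]
  rw [div_lt_iff₀ hε] at hmε'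
  linarith

lemma tendsto_singleCost (h : IsRandomModel P start goal split) :
    ∀ᵐ ω ∂P, ∀ cpd ct : ℝ, Tendsto (fun m : ℕ => singleCost cpd ct (firstPoints start (2 * m) ω)
      (firstPoints goal (2 * m) ω) / m) atTop (nhds (2 * (cpd + meanLength * ct))) := by
  filter_upwards [h.tendsto_sum_dist, h.tendsto_transitLength] with ω h1 h2 cpd ct
  have := ((h1.const_mul ct).add (h2.const_mul ct)).const_add (2 * cpd)
  rw [show 2 * cpd + (ct * (2 * meanLength) + ct * 0) = 2 * (cpd + meanLength * ct) by ring] at this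
  refine this.congr' ?_
  filter_upwards [eventually_gt_atTop 0] with m hm
  have hm0 : (m : ℝ) ≠ 0 := by exact_mod_cast hm.ne'
  rw [singleCost]
  push_cast
  field_simp
  ring

/-- The asymptotic cost of synchronized solutions, compared with a single arm. -/
theorem eventually_ratio_bounds (h : IsRandomModel P start goal split) (r : ℝ≥0)
    {D : ∀ (m : ℕ) (ω : Ω), SyncSolution r (firstPoints start (2 * m) ω)
      (firstPoints goal (2 * m) ω)}
    (hD : ∀ m ω (cpd ct : ℝ), 0 ≤ ct →
      m * cpd + ct * pairTransferCost (split m ω) (firstPoints start (2 * m) ω)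
        (firstPoints goal (2 * m) ω) ≤ (D m ω).cost cpd ct ∧
      ∀ B, HasOrdering (pairMoveCost (split m ω) (firstPoints start (2 * m) ω)
        (firstPoints goal (2 * m) ω)) Finset.univ B →
        (D m ω).cost cpd ct ≤ m * cpd + ct * (pairTransferCost (split m ω)
          (firstPoints start (2 * m) ω) (firstPoints goal (2 * m) ω) + B + 4 * r * m))
    {cpd ct : ℝ} (hct : 0 ≤ ct) (hpos : 0 < cpd + meanLength * ct) {ε : ℝ} (hε : 0 < ε) :
    ∀ᵐ ω ∂P, ∀ᶠ m : ℕ in atTop,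
      1 / 2 + (meanMaxLength - meanLength) / 2 * ct / (cpd + meanLength * ct) - ε
        < (D m ω).cost cpd ct / singleCost cpd ct (firstPoints start (2 * m) ω)
          (firstPoints goal (2 * m) ω) ∧
      (D m ω).cost cpd ct / singleCost cpd ct (firstPoints start (2 * m) ω)
          (firstPoints goal (2 * m) ω)
        < 1 / 2 + ((meanMaxLength - meanLength) / 2 + 2 * r) * ct / (cpd + meanLength * ct) + ε := by
  filter_upwards [h.tendsto_singleCost, h.tendsto_pairTransferCost, h.eventually_hasOrdering]
    with ω h1 h2 h3
  have h1 := h1 cpd ct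
  have hne' : cpd + meanLength * ct ≠ 0 := hpos.ne'
  have hne : 2 * (cpd + meanLength * ct) ≠ 0 := by positivity
  -- `η` is the budget per pair for the straight-line moves; its contribution to the limiting ratio
  -- has to stay below `ε`.
  obtain ⟨η, hη, hηε⟩ : ∃ η : ℝ, 0 < η ∧ ct * η / (2 * (cpd + meanLength * ct)) < ε := by
    refine ⟨ε * (cpd + meanLength * ct) / (ct + 1), by positivity, ?_⟩
    rw [div_lt_iff₀ (by positivity), ← mul_div_assoc, div_lt_iff₀ (by positivity)]
    nlinarith [mul_pos hε hpos, mul_nonneg hct (mul_pos hε hpos).le]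
  have hlow := ((h2.const_mul ct).const_add cpd).div h1 hne
  have hupp := (((h2.add_const (η + 4 * r)).const_mul ct).const_add cpd).div h1 hne
  have elow : (cpd + ct * meanMaxLength) / (2 * (cpd + meanLength * ct))
      = 1 / 2 + (meanMaxLength - meanLength) / 2 * ct / (cpd + meanLength * ct) := by
    rw [div_add_div _ _ two_ne_zero hne', div_eq_div_iff hne (mul_ne_zero two_ne_zero hne')]
    ring
  have eupp : (cpd + ct * (meanMaxLength + (η + 4 * r))) / (2 * (cpd + meanLength * ct))
      = 1 / 2 + ((meanMaxLength - meanLength) / 2 + 2 * r) * ct / (cpd + meanLength * ct)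
        + ct * η / (2 * (cpd + meanLength * ct)) := by
    rw [div_add_div _ _ two_ne_zero hne', div_add_div _ _ (mul_ne_zero two_ne_zero hne') hne,
      div_eq_div_iff hne (mul_ne_zero (mul_ne_zero two_ne_zero hne') hne)]
    ring
  rw [elow] at hlow
  rw [eupp] at hupp
  filter_upwards [hlow.eventually_const_lt (sub_lt_self _ hε),
    hupp.eventually_lt_const (add_lt_add_right hηε _), h3 η hη, eventually_gt_atTop 0,
    h1.eventually_const_lt (show 0 < 2 * (cpd + meanLength * ct) by positivity)]
    with m hl hu hord hm hs
  have hm0 : (0 : ℝ) < m := by exact_mod_cast hm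
  obtain ⟨hc1, hc2⟩ := hD m ω cpd ct hct
  have hc2 := hc2 _ hord
  rw [← div_div_div_cancel_right₀ hm0.ne' ((D m ω).cost cpd ct)]
  constructor
  · refine hl.trans_le (div_le_div_of_nonneg_right ?_ hs.le)
    rw [le_div_iff₀ hm0]
    refine le_trans (le_of_eq ?_) hc1
    field_simp
  · refine lt_of_le_of_lt (div_le_div_of_nonneg_right ?_ hs.le) hu
    rw [div_le_iff₀ hm0]
    refine hc2.trans (le_of_eq ?_)
    field_simp
    ring

end IsRandomModel

end model

end DualArm

/-! ### The main theorem and its two limiting regimes. -/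

theorem mainTheorem8 {Ω : Type*} [MeasurableSpace Ω] (P : Measure Ω) [IsProbabilityMeasure P]
    (start goal : ℕ → Ω → DualArm.Plane) (split : ∀ m, Ω → DualArm.Assignment m)
    (hmodel : DualArm.IsRandomModel P start goal split) :
    (∃ D : ∀ (r : ℝ≥0) (m : ℕ) (ω : Ω), DualArm.SyncSolution r
          (DualArm.firstPoints start (2 * m) ω) (DualArm.firstPoints goal (2 * m) ω),
      -- the pairs of the solution are the random ones
      (∀ r m ω, (D r m ω).HasPairs (split m ω)) ∧
      -- the asymptotic cost ratio
      (∀ (r : ℝ≥0) (cpd ct : ℝ), 0 ≤ cpd → 0 ≤ ct → 0 < cpd + ct → ∀ ε : ℝ, 0 < ε →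
        ∀ᵐ ω ∂P, ∀ᶠ m : ℕ in atTop,
          1 / 2 + (DualArm.meanMaxLength - DualArm.meanLength) / 2 * ct
              / (cpd + DualArm.meanLength * ct) - ε
            < (D r m ω).cost cpd ct / DualArm.singleCost cpd ct
                (DualArm.firstPoints start (2 * m) ω) (DualArm.firstPoints goal (2 * m) ω) ∧
          (D r m ω).cost cpd ct / DualArm.singleCost cpd ct
                (DualArm.firstPoints start (2 * m) ω) (DualArm.firstPoints goal (2 * m) ω)
            < 1 / 2 + ((DualArm.meanMaxLength - DualArm.meanLength) / 2 + 4 * Real.pi * r) * ct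
              / (cpd + DualArm.meanLength * ct) + ε) ∧
      -- the ratio is about `1/2` if `ct / cpd` is small
      (∀ (r : ℝ≥0), ∀ ε : ℝ, 0 < ε → ∃ δ : ℝ, 0 < δ ∧ ∀ cpd ct : ℝ, 0 < cpd → 0 ≤ ct → ct / cpd < δ →
        ∀ᵐ ω ∂P, ∀ᶠ m : ℕ in atTop,
          |(D r m ω).cost cpd ct / DualArm.singleCost cpd ct
              (DualArm.firstPoints start (2 * m) ω) (DualArm.firstPoints goal (2 * m) ω)
            - 1 / 2| < ε) ∧
      -- the ratio is about `E(max(l₁, l₂)) / (2 E(l))` if `cpd` (relative to `ct`) and `r` are small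
      (∀ ε : ℝ, 0 < ε → ∃ δ : ℝ, 0 < δ ∧ ∀ (r : ℝ≥0) (cpd ct : ℝ), (r : ℝ) < δ → 0 < ct → 0 ≤ cpd → cpd / ct < δ →
        ∀ᵐ ω ∂P, ∀ᶠ m : ℕ in atTop,
          |(D r m ω).cost cpd ct / DualArm.singleCost cpd ct
              (DualArm.firstPoints start (2 * m) ω) (DualArm.firstPoints goal (2 * m) ω)
            - DualArm.meanMaxLength / (2 * DualArm.meanLength)| < ε)) ∧
    -- the numerical values, correct to two decimals
    |DualArm.meanLength - 0.52| < 0.005 ∧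
    |DualArm.meanMaxLength - 0.66| < 0.005 ∧
    |DualArm.meanMaxLength / (2 * DualArm.meanLength) - 0.64| < 0.005 := by
  obtain ⟨n1, n2, n3⟩ := DualArm.mean_numerical_bounds
  have hl := abs_lt.1 n1
  have hu := abs_lt.1 n2
  have hlam : 0 < DualArm.meanLength := by linarith [hl.1]
  set lam := DualArm.meanLength with hlamdef
  set a := (DualArm.meanMaxLength - lam) / 2 with ha
  have ha0 : 0 < a := by rw [ha]; linarith [hl.2, hu.1]
  have hpi := Real.pi_gt_three
  choose D hpairs hcost using fun (r : ℝ≥0) (m : ℕ) (ω : Ω) =>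
    DualArm.exists_syncSolution r (split m ω) (DualArm.firstPoints start (2 * m) ω)
      (DualArm.firstPoints goal (2 * m) ω)
  have main : ∀ (r : ℝ≥0) (cpd ct : ℝ), 0 ≤ cpd → 0 ≤ ct → 0 < cpd + ct → ∀ ε : ℝ, 0 < ε →
      ∀ᵐ ω ∂P, ∀ᶠ m : ℕ in atTop,
        1 / 2 + a * ct / (cpd + lam * ct) - ε
          < (D r m ω).cost cpd ct / DualArm.singleCost cpd ct
              (DualArm.firstPoints start (2 * m) ω) (DualArm.firstPoints goal (2 * m) ω) ∧
        (D r m ω).cost cpd ct / DualArm.singleCost cpd ct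
              (DualArm.firstPoints start (2 * m) ω) (DualArm.firstPoints goal (2 * m) ω)
          < 1 / 2 + (a + 4 * Real.pi * r) * ct / (cpd + lam * ct) + ε := by
    intro r cpd ct hcpd hct hpos ε hε
    have hden : 0 < cpd + lam * ct := by
      rcases hct.eq_or_lt with h | h
      · rw [← h] at hpos ⊢; simpa using hpos
      · positivity
    filter_upwards [hmodel.eventually_ratio_bounds r (hcost r) hct hden hε] with ω hω
    filter_upwards [hω] with m hm
    refine ⟨hm.1, hm.2.trans_le ?_⟩
    gcongr
    -- The construction yields the constant `2 r`, which is at most `4 π r`.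
    nlinarith [r.2]
  refine ⟨⟨D, hpairs, main, ?_, ?_⟩, n1, n2, n3⟩
  · intro r ε hε
    have hb : 0 < a + 4 * Real.pi * r := by positivity
    refine ⟨ε / (2 * (a + 4 * Real.pi * r)), by positivity, fun cpd ct hcpd hct hδ => ?_⟩
    filter_upwards [main r cpd ct hcpd.le hct (by positivity) (ε / 2) (by positivity)] with ω hω
    filter_upwards [hω] with m hm
    have hx0 : 0 ≤ a * ct / (cpd + lam * ct) := by positivity
    have hx1 : (a + 4 * Real.pi * r) * ct / (cpd + lam * ct) < ε / 2 := by
      rw [lt_div_iff₀ (by positivity)] at hδ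
      calc (a + 4 * Real.pi * r) * ct / (cpd + lam * ct)
          ≤ (a + 4 * Real.pi * r) * ct / cpd := by
            gcongr
            exact le_add_of_nonneg_right (by positivity)
        _ < ε / 2 := by rw [mul_div_assoc]; linarith
    rw [abs_lt]
    constructor <;> linarith [hm.1, hm.2]
  · intro ε hε
    -- The deviation below `a / lam` is at most `a cpd / (lam² ct)`, and the one above is at most `4
    -- π r / lam`; the two entries make each at most `ε / 2`.
    refine ⟨min (ε * lam ^ 2 / (2 * a)) (ε * lam / (8 * Real.pi)), by positivity,
      fun r cpd ct hr hct hcpd hδ => ?_⟩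
    have hr' := hr.trans_le (min_le_right _ _)
    have hδ' := hδ.trans_le (min_le_left _ _)
    filter_upwards [main r cpd ct hcpd hct.le (by positivity) (ε / 2) (by positivity)] with ω hω
    filter_upwards [hω] with m hm
    have hlim : DualArm.meanMaxLength / (2 * lam) = 1 / 2 + a / lam := by
      rw [ha]; field_simp; ring
    have hlow : a / lam - ε / 2 ≤ a * ct / (cpd + lam * ct) := by
      have hy : a * (cpd / ct) ≤ ε / 2 * lam ^ 2 := by
        rw [lt_div_iff₀ (by positivity)] at hδ'; linarith
      have hy' : a * cpd ≤ ε / 2 * lam ^ 2 * ct := by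
        rwa [← mul_div_assoc, div_le_iff₀ hct] at hy
      rw [le_div_iff₀ (by positivity), sub_mul]
      have e1 : a / lam * (cpd + lam * ct) = a * cpd / lam + a * ct := by field_simp
      have e2 : a * cpd / lam ≤ ε / 2 * lam * ct := by
        rw [div_le_iff₀ hlam]; linarith
      have e3 : 0 ≤ ε / 2 * cpd := by positivity
      rw [e1]
      linarith
    have hupp : (a + 4 * Real.pi * r) * ct / (cpd + lam * ct) < a / lam + ε / 2 := by
      calc (a + 4 * Real.pi * r) * ct / (cpd + lam * ct)
          ≤ (a + 4 * Real.pi * r) * ct / (lam * ct) := by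
            gcongr
            exact le_add_of_nonneg_left hcpd
        _ = a / lam + 4 * Real.pi * r / lam := by field_simp
        _ < a / lam + ε / 2 := by
            rw [lt_div_iff₀ (by positivity)] at hr'
            rw [add_lt_add_iff_left, div_lt_iff₀ hlam]
            linarith
    rw [abs_lt, hlim]
    constructor <;> linarith [hm.1, hm.2]
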